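/- For $n\ge 2$ let $B_n=\langle\sigma_1,\dots,\sigma_{n-1}\mid \sigma_i\sigma_j=\sigma_j\sigma_i\ (|i-j|\ge2),\ \sigma_i\sigma_j\sigma_i=\sigma_j\sigma_i\sigma_j\ (|i-j|=1)\rangle$ be the $n$-strand braid group. For $1\le p<q\le n$ put $a_{p,q}=\sigma_p\cdots\sigma_{q-2}\,\sigma_{q-1}\,\sigma_{q-2}^{-1}\cdots\sigma_p^{-1}$, and let the dual braid monoid $BKL_n$ be the submonoid of $B_n$ generated by all these $a_{p,q}$. Let $\delta_n=\sigma_1\sigma_2\cdots\sigma_{n-1}$ and $\phi_n(\beta)=\delta_n\beta\delta_n^{-1}$. For $n\ge3$ the homomorphism $B_{n-1}\to B_n$, $\sigma_i\mapsto\sigma_i$, induces the canonical homomorphism $\iota\colon BKL_{n-1}\to BKL_n$, which is suppressed from the notation in the next two paragraphs. Let $n\ge3$. The $BKL_{n-1}$-tail of $\beta\in BKL_n$ is the maximal (with respect to right divisibility) right divisor of $\beta$ lying in $BKL_{n-1}$. The $\phi_n$-splitting of a nontrivial $\beta\in BKL_n$ is the unique sequence $(\beta_b,\dots,\beta_1)$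 of elements of $BKL_{n-1}$ such that $\beta_b\ne1$, $\beta=\phi_n^{b-1}(\beta_b)\cdots\phi_n(\beta_2)\,\beta_1$, and, for each $1\le k\le b$, the $BKL_{n-1}$-tail of $\phi_n^{b-k}(\beta_b)\cdots\phi_n(\beta_{k+1})$ is trivial; the $\phi_n$-splitting of $1$ is the sequence $(1)$. The length $b$ of the splitting is the $n$-breadth of $\beta$. The rotating relation $<^*_n$ on $BKL_n$ is defined recursively. On $BKL_2$, $\beta<^*_2\gamma$ means $\beta=a_{1,2}^{b}$ and $\gamma=a_{1,2}^{c}$ with $b<c$. For $n\ge3$, $\beta<^*_n\gamma$ means that the $\phi_n$-splitting of $\beta$ is smaller than that of $\gamma$ in the ShortLex extension of $<^*_{n-1}$: it is shorter, or the lengths are equal and it is lexicographically smaller, reading from the left, that is, starting with $\beta_b$. Then the following hold. 1. For every $n\ge2$, $<^*_n$ is a well-ordering on $BKL_n$, and for each $\beta\in BKL_n$ the immediate $<^*_n$-successor of $\beta$ is $\beta\,a_{1,2}=\beta\,\sigma_1$. 2. For every $n\ge3$, the canonical homomorphism $\iota\colon BKL_{n-1}\to BKL_n$ is injective and satisfies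 $\iota(\beta)<^*_n\iota(\gamma)\iff\beta<^*_{n-1}\gamma$, and its image is the initial segment of $(BKL_n,<^*_n)$ determined by $a_{n-1,n}$, i.e. $BKL_{n-1}=\{\beta\in BKL_n\mid\beta<^*_n a_{n-1,n}\}$. Moreover, $a_{n-1,n}$ has $n$-breadth $2$ and is the $<^*_n$-smallest braid of $n$-breadth $2$. -/

import Mathlib

/-- The defining relations of Artin's `n`-strand braid group. The generators are indexed by the
integers `i` with `1 ≤ i ≤ n - 1`, and a relation `u = v` is encoded by the element `u * v⁻¹`. -/
inductive ArtinRel (n : ℕ) : FreeGroup {i : ℕ // 1 ≤ i ∧ i < n} → Prop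
  | comm (i j : {i : ℕ // 1 ≤ i ∧ i < n}) (h : i.1 + 2 ≤ j.1) :
      ArtinRel n (FreeGroup.of i * FreeGroup.of j *
        (FreeGroup.of j * FreeGroup.of i)⁻¹)
  | braid (i j : {i : ℕ // 1 ≤ i ∧ i < n}) (h : j.1 = i.1 + 1) :
      ArtinRel n (FreeGroup.of i * FreeGroup.of j * FreeGroup.of i *
        (FreeGroup.of j * FreeGroup.of i * FreeGroup.of j)⁻¹)

/-- Artin's braid group `B_n` on `n` strands, given by its presentation. -/
abbrev ArtinBraid (n : ℕ) : Type :=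
  PresentedGroup {r : FreeGroup {i : ℕ // 1 ≤ i ∧ i < n} | ArtinRel n r}

namespace ArtinBraid

/-- The generator `σ_i` of `B_n`, for `1 ≤ i ≤ n - 1` (and `1` for the other values of `i`, which
are never used). -/
def sigma (n i : ℕ) : ArtinBraid n :=
  if h : 1 ≤ i ∧ i < n then PresentedGroup.of ⟨i, h⟩ else 1

theorem sigma_comm (n : ℕ) {i j : ℕ} (hi : 1 ≤ i) (hij : i + 2 ≤ j) (hj : j < n) :
    sigma n i * sigma n j = sigma n j * sigma n i := by
  have h1 : 1 ≤ i ∧ i < n := ⟨hi, by omega⟩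
  have h2 : 1 ≤ j ∧ j < n := ⟨by omega, hj⟩
  have h := PresentedGroup.one_of_mem
    (rels := {r : FreeGroup {i : ℕ // 1 ≤ i ∧ i < n} | ArtinRel n r})
    (ArtinRel.comm ⟨i, h1⟩ ⟨j, h2⟩ hij)
  simp only [map_mul, map_inv] at h
  simp only [sigma, h1, h2, and_self, dif_pos]
  exact mul_inv_eq_one.1 h

theorem sigma_braid (n : ℕ) {i : ℕ} (hi : 1 ≤ i) (hj : i + 1 < n) :
    sigma n i * sigma n (i + 1) * sigma n i = sigma n (i + 1) * sigma n i * sigma n (i + 1) := by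
  have h1 : 1 ≤ i ∧ i < n := ⟨hi, by omega⟩
  have h2 : 1 ≤ i + 1 ∧ i + 1 < n := ⟨by omega, hj⟩
  have h := PresentedGroup.one_of_mem
    (rels := {r : FreeGroup {i : ℕ // 1 ≤ i ∧ i < n} | ArtinRel n r})
    (ArtinRel.braid ⟨i, h1⟩ ⟨i + 1, h2⟩ rfl)
  simp only [map_mul, map_inv] at h
  simp only [sigma, dif_pos h1, dif_pos h2]
  exact mul_inv_eq_one.1 h

/-- The canonical homomorphism `B_n → B_{n+1}`, which sends `σ_i` to `σ_i` for `1 ≤ i ≤ n - 1`. -/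
def incl (n : ℕ) : ArtinBraid n →* ArtinBraid (n + 1) :=
  PresentedGroup.toGroup (f := fun i => sigma (n + 1) i.1) (by
    intro r hr
    cases hr with
    | comm i j h =>
      simp only [map_mul, map_inv, FreeGroup.lift_apply_of]
      exact mul_inv_eq_one.2 (sigma_comm (n + 1) i.2.1 h (by have := j.2.2; omega))
    | braid i j h =>
      simp only [map_mul, map_inv, FreeGroup.lift_apply_of, h]
      exact mul_inv_eq_one.2
        (sigma_braid (n + 1) i.2.1 (by have := j.2.2; omega)))

theorem incl_sigma (n : ℕ) {i : ℕ} (h : 1 ≤ i ∧ i < n) :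
    incl n (sigma n i) = sigma (n + 1) i := by
  simp only [sigma, dif_pos h, incl]
  rw [PresentedGroup.toGroup.of]

/-- The braid `δ_{p,q} = σ_p σ_{p+1} ⋯ σ_{q-1}` of `B_n` (for `1 ≤ p ≤ q ≤ n`). -/
def delta (n p q : ℕ) : ArtinBraid n :=
  ((List.range' p (q - p)).map (sigma n)).prod

/-- The Birman-Ko-Lee generator
`a_{p,q} = σ_p ⋯ σ_{q-2} σ_{q-1} σ_{q-2}⁻¹ ⋯ σ_p⁻¹` of `B_n` (for `1 ≤ p < q ≤ n`). -/
def a (n p q : ℕ) : ArtinBraid n :=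
  delta n p (q - 1) * sigma n (q - 1) * (delta n p (q - 1))⁻¹

/-- The rotation automorphism `φ_n : β ↦ δ_n β δ_n⁻¹`, where `δ_n = σ_1 σ_2 ⋯ σ_{n-1}`. -/
def phi (n : ℕ) : MulAut (ArtinBraid n) :=
  MulAut.conj (delta n 1 n)

theorem incl_delta (n : ℕ) {p q : ℕ} (hp : 1 ≤ p) (hq : q ≤ n) :
    incl n (delta n p q) = delta (n + 1) p q := by
  simp only [delta, map_list_prod, List.map_map]
  congr 1
  apply List.map_congr_left
  intro i hi
  rw [List.mem_range'_1] at hi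
  exact incl_sigma n ⟨by omega, by omega⟩

theorem incl_a (n : ℕ) {p q : ℕ} (hp : 1 ≤ p) (hpq : p < q) (hq : q ≤ n) :
    incl n (a n p q) = a (n + 1) p q := by
  simp only [a, map_mul, map_inv]
  rw [incl_delta n hp (by omega), incl_sigma n ⟨by omega, by omega⟩]

end ArtinBraid

/-- The dual braid monoid `BKL_n`: the submonoid of `B_n` generated by the Birman-Ko-Lee generators
`a_{p,q}` with `1 ≤ p < q ≤ n`. -/
def BKL (n : ℕ) : Submonoid (ArtinBraid n) :=
  Submonoid.closure {β | ∃ p q : ℕ, 1 ≤ p ∧ p < q ∧ q ≤ n ∧ β = ArtinBraid.a n p q}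

namespace BKL

/-- The generator `a_{p,q}` as an element of `BKL_n`. -/
def gen (n p q : ℕ) (hp : 1 ≤ p) (hpq : p < q) (hq : q ≤ n) : BKL n :=
  ⟨ArtinBraid.a n p q, Submonoid.subset_closure ⟨p, q, hp, hpq, hq, rfl⟩⟩

theorem incl_mem (n : ℕ) (β : BKL n) : ArtinBraid.incl n β ∈ BKL (n + 1) := by
  suffices h : BKL n ≤ (BKL (n + 1)).comap (ArtinBraid.incl n) from h β.2
  refine Submonoid.closure_le.2 ?_
  rintro _ ⟨p, q, hp, hpq, hq, rfl⟩
  exact Submonoid.subset_closure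
    ⟨p, q, hp, hpq, by omega, ArtinBraid.incl_a n hp hpq hq⟩

/-- The canonical embedding of `BKL_n` into `BKL_{n+1}`, induced by `σ_i ↦ σ_i`. -/
def incl (n : ℕ) : BKL n →* BKL (n + 1) :=
  ((ArtinBraid.incl n).comp (BKL n).subtype).codRestrict (BKL (n + 1)) (incl_mem n)

/-- `RightDvd n α β`: the element `α` is a right divisor of `β` in the monoid `BKL_n`. Both
arguments are written as elements of the ambient group `B_n`. -/
def RightDvd (n : ℕ) (α β : ArtinBraid n) : Prop :=
  ∃ γ ∈ BKL n, β = γ * α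

/-- `IsTail n β τ`: the braid `τ` is the `BKL_n`-tail of the element `β` of `BKL_{n+1}`, i.e. the
maximal (for right divisibility) right divisor of `β` that lies in `BKL_n`. -/
def IsTail (n : ℕ) (β : ArtinBraid (n + 1)) (τ : BKL n) : Prop :=
  RightDvd (n + 1) (incl n τ) β ∧
    ∀ τ' : BKL n, RightDvd (n + 1) (incl n τ') β → RightDvd n τ' τ

/-- For a finite sequence `(β_b, …, β_1)` of elements of `BKL_n`, the braid
`φ^{b-1}(β_b) ⋯ φ(β_2) β_1` of `B_{n+1}`, where `φ = φ_{n+1}`. -/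
def rotProd (n : ℕ) : List (BKL n) → ArtinBraid (n + 1)
  | [] => 1
  | β :: s => (ArtinBraid.phi (n + 1) ^ s.length) (incl n β) * rotProd n s

/-- `IsSplitting n β s`: the sequence `s = (β_b, …, β_1)` of elements of `BKL_n` (listed in this
order) is the `φ_{n+1}`-splitting of the element `β` of `BKL_{n+1}`. This means that
* the sequence is nonempty, and its first entry `β_b` is not `1`, except that the
  splitting of the trivial braid is the sequence `(1)` of length one;
* `β = φ^{b-1}(β_b) ⋯ φ(β_2) β_1`;
* for `1 ≤ k ≤ b` the `BKL_n`-tail of `φ^{b-k}(β_b) ⋯ φ(β_{k+1})` is trivial; this braid is the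
  image under `φ` of the product associated with `(β_b, …, β_{k+1})`. -/
def IsSplitting (n : ℕ) (β : BKL (n + 1)) (s : List (BKL n)) : Prop :=
  s ≠ [] ∧ (s.head? = some 1 → s.length = 1) ∧
    (β : ArtinBraid (n + 1)) = rotProd n s ∧
    ∀ k : ℕ, 1 ≤ k → k ≤ s.length →
      IsTail n (ArtinBraid.phi (n + 1) (rotProd n (s.take (s.length - k)))) 1

/-- `HasBreadth n β b`: the element `β` of `BKL_{n+1}` has `(n+1)`-breadth `b`, i.e. its
`φ_{n+1}`-splitting has length `b`. -/
def HasBreadth (n : ℕ) (β : BKL (n + 1)) (b : ℕ) : Prop :=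
  ∃ s : List (BKL n), IsSplitting n β s ∧ s.length = b

/-- The rotating relation `<*_n` on `BKL_n`, for `n ≥ 2`. On `BKL_2` it compares the exponents of
`a_{1,2}`; on `BKL_n` with `n ≥ 3` it compares the `φ_n`-splittings in the ShortLex extension of the
relation on `BKL_{n-1}`. (The values for `n = 0` and `n = 1` are never used.) -/
def RotLT : (n : ℕ) → BKL n → BKL n → Prop
  | 0 => fun _ _ => False
  | 1 => fun _ _ => False
  | 2 => fun β γ => ∃ b c : ℕ, b < c ∧
      (β : ArtinBraid 2) = ArtinBraid.a 2 1 2 ^ b ∧ (γ : ArtinBraid 2) = ArtinBraid.a 2 1 2 ^ c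
  | n + 3 => fun β γ => ∃ s t : List (BKL (n + 2)),
      IsSplitting (n + 2) β s ∧ IsSplitting (n + 2) γ t ∧ List.Shortlex (RotLT (n + 2)) s t

end BKL

/-! Everything rests on one property of dual braid monoids: if `x` and `y` lie in `BKL_n` and both
right-divide `β` in `BKL_{n+1}`, then some common left multiple of them in `BKL_n` also
right-divides `β` (`exists_common_multiple`). Hence `BKL_n`-tails exist (`exists_isTail`), and if
`γ` has trivial tail then `γ x` has tail `x` (`isTail_mul`). So splittings are unique. They exist
for three or more strands because two backward rotations suffice to bring any atom into the smaller
monoid (`exists_rotation`), so that removing tails eventually decreases the length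
(`exists_isReduced`).

The common multiple property is Garside theory. Simple elements are modelled by the permutations
below the long cycle `c` in the absolute order, where length is the codimension of the space of
invariant functions. Any two elements below `c` have a greatest lower bound (`exists_inf`), so
greedy normal sequences can be multiplied on the right by simple elements. Multiplication by `c` is
a shift, hence injective. Inverting a central power of `c` turns these maps into permutations
satisfying the Hurwitz relations, which gives an action of the braid group (`normalAction`). Acting
on the trivial sequence computes normal forms, and the rightmost term of the normal form contains
every atom that right-divides the braid (`exists_simple_tail`). Meeting this term with the long
cycle on all points but the last gives the common multiple, by induction on length.

The order statements are then formal. ShortLex of a well-order is well-founded, and splittings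
determine braids. Right multiplication by `a_{1,2}` changes only the last entry of a splitting, so
successors are handled by induction on the number of strands. An element of `BKL_n` has a splitting
of length one, and `a_{n,n+1}` has splitting `(a_{n-1,n}, 1)` for `n ≥ 3`, and `(a_{1,2}, 1)` is the
splitting of `a_{2,3}`. A nontrivial leading entry below that of `a_{n,n+1}` would itself come from
fewer strands, so its rotation would have a nontrivial tail; hence nothing of breadth two lies below
`a_{n,n+1}`. Injectivity of `B_n → B_{n+1}` is proved by forgetting a strand (`forget_incl`). -/

set_option linter.unusedSectionVars false

/-! ### The absolute order on permutations and its meets -/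

section

open Equiv Module

namespace AbsOrder

variable {α : Type*}

/-- The functions which are invariant under the permutation `w`. -/
def fixSpace (w : Perm α) : Submodule ℚ (α → ℚ) where
  carrier := {f | ∀ i, f (w i) = f i}
  add_mem' := fun hf hg i => by simp [hf i, hg i]
  zero_mem' := fun i => rfl
  smul_mem' := fun c f hf i => by simp [hf i]

theorem mem_fixSpace {w : Perm α} {f : α → ℚ} : f ∈ fixSpace w ↔ ∀ i, f (w i) = f i := Iff.rfl

theorem fixSpace_inf_le_mul (a b : Perm α) : fixSpace a ⊓ fixSpace b ≤ fixSpace (a * b) := by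
  rintro f ⟨h1, h2⟩ i
  rw [Perm.mul_apply, h1, h2]

theorem fixSpace_conj (g a : Perm α) :
    fixSpace (g * a * g⁻¹) = (fixSpace a).map (LinearEquiv.funCongrLeft ℚ ℚ g.symm).toLinearMap := by
  ext f
  rw [Submodule.mem_map]
  constructor
  · intro h
    refine ⟨fun i => f (g i), fun i => ?_, ?_⟩
    · have := h (g i)
      simpa using this
    · ext i
      simp [LinearEquiv.funCongrLeft, LinearMap.funLeft]
  · rintro ⟨f, h, rfl⟩ i
    have := h (g.symm i)
    simpa [LinearEquiv.funCongrLeft, LinearMap.funLeft, Perm.inv_def] using this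

variable [Fintype α]

/-- The absolute length of a permutation, as the codimension of its fixed space. -/
noncomputable def len (w : Perm α) : ℕ := Fintype.card α - finrank ℚ (fixSpace w)

theorem len_add_finrank (w : Perm α) : len w + finrank ℚ (fixSpace w) = Fintype.card α := by
  have : finrank ℚ (fixSpace w) ≤ finrank ℚ (α → ℚ) := Submodule.finrank_le _
  rw [finrank_fintype_fun_eq_card] at this
  unfold len
  omega

theorem len_one : len (1 : Perm α) = 0 := by
  have h : fixSpace (1 : Perm α) = ⊤ := by
    ext f
    simp [mem_fixSpace]
  have := len_add_finrank (1 : Perm α)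
  rw [h, finrank_top, finrank_fintype_fun_eq_card] at this
  omega

theorem len_mul_le (a b : Perm α) : len (a * b) ≤ len a + len b := by
  have h1 := Submodule.finrank_sup_add_finrank_inf_eq (fixSpace a) (fixSpace b)
  have h2 : finrank ℚ ↥(fixSpace a ⊔ fixSpace b) ≤ finrank ℚ (α → ℚ) := Submodule.finrank_le _
  rw [finrank_fintype_fun_eq_card] at h2
  have h3 := Submodule.finrank_mono (fixSpace_inf_le_mul a b)
  have := len_add_finrank a
  have := len_add_finrank b
  have := len_add_finrank (a * b)
  omega

/-- The sum of the two spaces is at most the whole space, so additivity of lengths makes the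
intersection at least as large as the space it is contained in. -/
theorem fixSpace_mul_of_len {a b : Perm α} (h : len (a * b) = len a + len b) :
    fixSpace (a * b) = fixSpace a ⊓ fixSpace b := by
  symm
  apply Submodule.eq_of_le_of_finrank_le (fixSpace_inf_le_mul a b)
  have h1 := Submodule.finrank_sup_add_finrank_inf_eq (fixSpace a) (fixSpace b)
  have h2 : finrank ℚ ↥(fixSpace a ⊔ fixSpace b) ≤ finrank ℚ (α → ℚ) := Submodule.finrank_le _
  rw [finrank_fintype_fun_eq_card] at h2
  have := len_add_finrank a
  have := len_add_finrank b
  have := len_add_finrank (a * b)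
  omega

theorem len_conj (g a : Perm α) : len (g * a * g⁻¹) = len a := by
  have h : finrank ℚ (fixSpace (g * a * g⁻¹)) = finrank ℚ (fixSpace a) := by
    rw [fixSpace_conj]
    exact LinearEquiv.finrank_map_eq _ _
  unfold len
  rw [h]

theorem len_lt_of_fixSpace_lt {a b : Perm α} (h : fixSpace b < fixSpace a) : len a < len b := by
  have := Submodule.finrank_lt_finrank_of_lt h
  have := len_add_finrank a
  have := len_add_finrank b
  omega

/-- The absolute order on permutations. -/
def Le (a b : Perm α) : Prop := len (b * a⁻¹) + len a = len b

theorem le_mul_iff {y z : Perm α} : Le z (y * z) ↔ len (y * z) = len y + len z := by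
  simp only [Le, mul_inv_cancel_right]
  exact eq_comm

/-- Length is invariant under conjugation, so being a left factor and being a right factor are the
same condition. -/
theorem le_mul_iff' {y z : Perm α} : Le y (y * z) ↔ len (y * z) = len y + len z := by
  simp only [Le, len_conj]
  constructor <;> intro h <;> omega

theorem Le.refl (a : Perm α) : Le a a := by simp [Le, len_one]

theorem one_le (a : Perm α) : Le 1 a := by simp [Le, len_one]

theorem Le.len_le {a b : Perm α} (h : Le a b) : len a ≤ len b := by
  unfold Le at h
  omega

theorem Le.trans {a b d : Perm α} (h1 : Le a b) (h2 : Le b d) : Le a d := by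
  unfold Le at *
  have h3 := len_mul_le (d * b⁻¹) (b * a⁻¹)
  have h4 := len_mul_le (d * a⁻¹) a
  simp only [inv_mul_cancel_right] at h4
  rw [show d * b⁻¹ * (b * a⁻¹) = d * a⁻¹ by group] at h3
  omega

theorem Le.div_le {a b : Perm α} (h : Le a b) : Le (b * a⁻¹) b := by
  have := (le_mul_iff' (y := b * a⁻¹) (z := a)).2
  simp only [inv_mul_cancel_right] at this
  exact this (by unfold Le at h; omega)

theorem Le.ldiv_le {a b : Perm α} (h : Le a b) : Le (a⁻¹ * b) b := by
  have h1 := (le_mul_iff (y := a) (z := a⁻¹ * b)).2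
  rw [mul_inv_cancel_left] at h1
  refine h1 ?_
  have h2 : len (a⁻¹ * b) = len (b * a⁻¹) := by
    rw [← len_conj a, show a * (a⁻¹ * b) * a⁻¹ = b * a⁻¹ by group]
  unfold Le at h
  omega

theorem Le.div_mono {a b d : Perm α} (h1 : Le a b) (h2 : Le b d) :
    Le (b * a⁻¹) (d * a⁻¹) := by
  have h3 := h1.trans h2
  unfold Le at *
  rw [show d * a⁻¹ * (b * a⁻¹)⁻¹ = d * b⁻¹ by group]
  omega

theorem Le.of_le_div {y a d : Perm α} (h1 : Le a d) (h2 : Le y (d * a⁻¹)) :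
    Le a (y * a) ∧ Le (y * a) d := by
  rw [le_mul_iff]
  unfold Le at *
  have h3 := len_mul_le y a
  have h4 := len_mul_le (d * (y * a)⁻¹) (y * a)
  rw [inv_mul_cancel_right] at h4
  rw [show d * a⁻¹ * y⁻¹ = d * (y * a)⁻¹ by group] at h2
  omega

theorem Le.of_div_le_div {a b d : Perm α} (h2 : Le a d)
    (h3 : Le (b * a⁻¹) (d * a⁻¹)) : Le b d := by
  have := (Le.of_le_div h2 h3).2
  rwa [inv_mul_cancel_right] at this

theorem Le.le_div {y a d : Perm α} (h1 : Le a (y * a)) (h2 : Le (y * a) d) : Le y (d * a⁻¹) := by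
  have := Le.div_mono h1 h2
  rwa [mul_inv_cancel_right] at this

theorem Le.fixSpace_le {a b : Perm α} (h : Le a b) : fixSpace b ≤ fixSpace a := by
  have h1 : len (b * a⁻¹ * a) = len (b * a⁻¹) + len a := by
    rw [inv_mul_cancel_right]
    exact h.symm
  have := fixSpace_mul_of_len h1
  rw [inv_mul_cancel_right] at this
  rw [this]
  exact inf_le_right

variable [DecidableEq α]

/-- A `w`-invariant function takes equal values at `p` and `w p`, so nothing is lost; `p` becomes a
fixed point, so its indicator function is gained. -/
theorem fixSpace_lt_swap_mul {w : Perm α} {p : α} (h : w p ≠ p) :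
    fixSpace w < fixSpace (swap p (w p) * w) := by
  refine lt_of_le_of_ne ?_ fun heq => ?_
  · intro f hf i
    have h1 : ∀ j, f (swap p (w p) j) = f j := by
      intro j
      rw [swap_apply_def]
      split_ifs with h2 h3
      · rw [h2, hf p]
      · rw [h3, hf p]
      · rfl
    rw [Perm.mul_apply, h1, hf i]
  · have h1 : Pi.single p (1 : ℚ) ∈ fixSpace (swap p (w p) * w) := by
      intro i
      by_cases hi : i = p
      · subst hi
        simp
      · have : (swap p (w p) * w) i ≠ p := by
          intro h2
          rw [Perm.mul_apply, swap_apply_eq_iff, swap_apply_left] at h2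
          exact hi (w.injective h2)
        rw [Pi.single_eq_of_ne this, Pi.single_eq_of_ne hi]
    rw [← heq] at h1
    have := h1 p
    rw [Pi.single_eq_of_ne h, Pi.single_eq_same] at this
    exact zero_ne_one this

theorem len_eq_zero {w : Perm α} : len w = 0 ↔ w = 1 := by
  constructor
  · intro h
    by_contra hw
    obtain ⟨p, hp⟩ : ∃ p, w p ≠ p := by
      by_contra! h1
      exact hw (Equiv.ext h1)
    have := len_lt_of_fixSpace_lt (fixSpace_lt_swap_mul hp)
    omega
  · rintro rfl
    exact len_one

theorem Le.eq_of_len {a b : Perm α} (h : Le a b) (h1 : len b ≤ len a) : a = b := by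
  have : len (b * a⁻¹) = 0 := by
    unfold Le at h
    omega
  rw [len_eq_zero, mul_inv_eq_one] at this
  exact this.symm

theorem Le.antisymm {a b : Perm α} (h : Le a b) (h1 : Le b a) : a = b := h.eq_of_len h1.len_le

theorem eq_one_of_le_one {a : Perm α} (h : Le a 1) : a = 1 := h.antisymm (one_le a)

theorem len_swap {p q : α} (h : p ≠ q) : len (swap p q) = 1 := by
  have h0 : len (swap p q) ≠ 0 := by
    rw [Ne, len_eq_zero, swap_eq_one_iff]
    exact h
  let g : (α → ℚ) →ₗ[ℚ] ℚ :=
    LinearMap.proj (R := ℚ) (φ := fun _ => ℚ) p - LinearMap.proj (R := ℚ) (φ := fun _ => ℚ) q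
  have h1 := LinearMap.finrank_range_add_finrank_ker g
  have h2 : finrank ℚ (LinearMap.range g) ≤ finrank ℚ ℚ := Submodule.finrank_le _
  have h3 : LinearMap.ker g ≤ fixSpace (swap p q) := by
    intro f hf i
    have : f p = f q := by
      rw [LinearMap.mem_ker] at hf
      simpa [g, sub_eq_zero] using hf
    rw [swap_apply_def]
    split_ifs with h4 h5
    · rw [h4, this]
    · rw [h5, this]
    · rfl
  have h4 := Submodule.finrank_mono h3
  rw [finrank_self] at h2
  rw [finrank_fintype_fun_eq_card] at h1
  have := len_add_finrank (swap p q)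
  omega

/-- Splitting a moved point off its cycle lowers the length by exactly one. The parity later
excludes that `w` and `w * swap p q` have equal length. -/
theorem sign_eq_pow_len (w : Perm α) : Perm.sign w = (-1) ^ len w := by
  induction h : len w using Nat.strong_induction_on generalizing w with
  | _ k ih =>
    by_cases hw : w = 1
    · subst hw
      rw [len_one] at h
      simp [← h]
    · obtain ⟨p, hp⟩ : ∃ p, w p ≠ p := by
        by_contra! h1
        exact hw (Equiv.ext h1)
      have h1 := len_lt_of_fixSpace_lt (fixSpace_lt_swap_mul hp)
      have h2 := len_mul_le (swap p (w p)) (swap p (w p) * w)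
      rw [← mul_assoc, swap_mul_self, one_mul, len_swap (Ne.symm hp)] at h2
      have h3 := ih _ (by omega) (swap p (w p) * w) rfl
      rw [Perm.sign_mul, Perm.sign_swap (Ne.symm hp)] at h3
      rw [show k = len (swap p (w p) * w) + 1 by omega, pow_succ, ← h3]
      simp

/-- The points `p` and `q` are in the same cycle of `w`. -/
def Same (w : Perm α) (p q : α) : Prop := ∀ f ∈ fixSpace w, f p = f q

omit [Fintype α] [DecidableEq α] in
theorem same_iff {w : Perm α} {p q : α} : Same w p q ↔ w.SameCycle p q := by
  classical
  constructor
  · intro h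
    have := h (fun i => if w.SameCycle p i then 1 else 0) (by
      intro i
      simp [Perm.sameCycle_apply_right])
    by_contra hn
    simp [Perm.SameCycle.refl, hn] at this
  · rintro ⟨k, rfl⟩ f hf
    have h1 : ∀ k : ℕ, ∀ i, f ((w ^ k) i) = f i := by
      intro k
      induction k with
      | zero => intro i; rfl
      | succ k ih => intro i; rw [pow_succ', Perm.mul_apply, hf, ih]
    cases k with
    | ofNat k => exact (h1 k p).symm
    | negSucc k =>
      have := h1 (k + 1) ((w ^ Int.negSucc k) p)
      rw [← this, zpow_negSucc, ← Perm.mul_apply, mul_inv_cancel]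
      rfl

theorem Le.same {a b : Perm α} (h : Le a b) {p q : α} (h1 : Same a p q) : Same b p q :=
  fun f hf => h1 f (h.fixSpace_le hf)

/-- By parity and subadditivity the length of `w * swap p q` differs from that of `w` by one. It
cannot go up: the invariants of the product would then be the common invariants, which are all those
of `w`. -/
theorem swap_le_of_same {w : Perm α} {p q : α} (h : Same w p q) : Le (swap p q) w := by
  by_cases hpq : p = q
  · subst hpq
    rw [swap_self]
    exact one_le w
  have h0 := len_swap hpq
  have h1 := len_mul_le w (swap p q)
  have h2 := len_mul_le (w * swap p q) (swap p q)
  rw [mul_assoc, swap_mul_self, mul_one] at h2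
  have h3 : len (w * swap p q) ≠ len w := by
    intro h4
    have h5 := sign_eq_pow_len (w * swap p q)
    rw [h4, ← sign_eq_pow_len, Perm.sign_mul, Perm.sign_swap hpq] at h5
    simp at h5
  have h4 : len (w * swap p q) ≠ len w + len (swap p q) := by
    intro h5
    have h6 := fixSpace_mul_of_len h5
    have h7 : fixSpace w ≤ fixSpace (swap p q) := by
      intro f hf i
      rw [swap_apply_def]
      split_ifs with h8 h9
      · rw [h8, h f hf]
      · rw [h9, h f hf]
      · rfl
    rw [inf_eq_left.2 h7] at h6
    have := len_add_finrank w
    have := len_add_finrank (w * swap p q)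
    rw [h6] at this
    omega
  unfold Le
  rw [swap_inv]
  omega

theorem same_of_fix {w : Perm α} {p q : α} (h : w p = q) : Same w p q :=
  fun f hf => by rw [← h, hf p]

theorem same_swap (p q : α) : Same (swap p q) p q := same_of_fix (swap_apply_left p q)

theorem swap_le_iff {w : Perm α} {p q : α} : Le (swap p q) w ↔ Same w p q :=
  ⟨fun h => h.same (same_swap p q), swap_le_of_same⟩

theorem exists_swap_le {w : Perm α} (hw : w ≠ 1) : ∃ p q, p ≠ q ∧ Le (swap p q) w := by
  obtain ⟨p, hp⟩ : ∃ p, w p ≠ p := by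
    by_contra! h1
    exact hw (Equiv.ext h1)
  exact ⟨p, w p, Ne.symm hp, swap_le_of_same (same_of_fix rfl)⟩

theorem Same.symm {w : Perm α} {p q : α} (h : Same w p q) : Same w q p := fun f hf => (h f hf).symm

theorem Same.trans {w : Perm α} {p q r : α} (h : Same w p q) (h1 : Same w q r) : Same w p r :=
  fun f hf => (h f hf).trans (h1 f hf)

theorem not_same_mul_swap {w : Perm α} {r s : α} (hrs : r ≠ s) (h : Le (swap r s) w) :
    ¬ Same (w * swap r s) r s := by
  intro h1
  have h2 := swap_le_of_same h1
  have := len_swap hrs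
  unfold Le at h h2
  rw [swap_inv] at h h2
  rw [mul_assoc, swap_mul_self, mul_one] at h2
  omega

/-- If `p` and `q` are in one cycle of `w`, then removing the transposition `(r s)` either keeps them
together, or separates them as it separates `r` and `s`. -/
theorem same_mul_swap_cases {w : Perm α} {p q r s : α} (h : Same w p q) :
    Same (w * swap r s) p q ∨
    (Same (w * swap r s) p r ∧ Same (w * swap r s) q s) ∨
    (Same (w * swap r s) p s ∧ Same (w * swap r s) q r) := by
  classical
  by_cases h1 : Same (w * swap r s) p q
  · exact Or.inl h1
  -- If the new cycle of `x` avoided both `r` and `s`, its indicator would be `w`-invariant and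
  -- would separate `x` from `y`.
  have key : ∀ x y, Same w x y → ¬ Same (w * swap r s) x y →
      Same (w * swap r s) x r ∨ Same (w * swap r s) x s := by
    intro x y hxy hn
    by_contra! hc
    simp only [same_iff] at hn hc
    refine absurd (hxy (fun i => if (w * swap r s).SameCycle x i then 1 else 0) ?_) ?_
    · intro i
      have h3 : ∀ i, (if (w * swap r s).SameCycle x ((w * swap r s) i) then (1 : ℚ) else 0) =
        if (w * swap r s).SameCycle x i then 1 else 0 := by
        intro i
        simp only [Perm.sameCycle_apply_right]
      have h4 := h3 (swap r s i)
      rw [Perm.mul_apply, swap_apply_self] at h4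
      refine h4.trans ?_
      rw [swap_apply_def]
      split_ifs <;> simp_all
    · simp [hn, Perm.SameCycle.refl]
  have hq := key q p h.symm (fun h2 => h1 h2.symm)
  rcases key p q h h1 with hp | hp <;> rcases hq with hq | hq
  · exact absurd (hp.trans hq.symm) h1
  · exact Or.inr (Or.inl ⟨hp, hq⟩)
  · exact Or.inr (Or.inr ⟨hp, hq⟩)
  · exact absurd (hp.trans hq.symm) h1

/-- Transpositions inside distinct cycles of `v` are jointly below `v`. -/
theorem same_mul_swap_of_not_same {v : Perm α} {p q r s : α} (h1 : Same v p r) (h2 : Same v q s)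
    (h3 : ¬ Same v p q) : Same (v * swap q s) p r := by
  classical
  intro g hg
  -- The cycle of `p` avoids `q` and `s`, so on it `g` is invariant under `v` itself; extension by
  -- zero keeps this.
  have h4 : (fun i => if v.SameCycle p i then g i else 0) ∈ fixSpace v := by
    intro i
    by_cases hi : v.SameCycle p i
    · have hq : i ≠ q := by
        rintro rfl
        exact h3 (same_iff.2 hi)
      have hs : i ≠ s := by
        rintro rfl
        exact h3 ((same_iff.2 hi).trans h2.symm)
      have := hg i
      rw [Perm.mul_apply, swap_apply_of_ne_of_ne hq hs] at this
      simp [Perm.sameCycle_apply_right, hi, this]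
    · simp [Perm.sameCycle_apply_right, hi]
  have := h1 _ h4
  simpa [Perm.SameCycle.refl, same_iff.1 h1] using this

theorem swap_mul_swap_le {w : Perm α} {p q r s : α} (ht : Le (swap r s) w)
    (h : Same (w * swap r s) p q) : Le (swap r s) (swap p q * swap r s) ∧
      Le (swap p q * swap r s) w := by
  apply Le.of_le_div ht
  rw [swap_inv]
  exact swap_le_of_same h

/-- The case where removing `(r s)` separates `p` from `q`. The transpositions `(p r)` and `(q s)`
then lie in different cycles and can be put back together with `(r s)`; the product depends on `p,
q, r, s` only, not on `w`. -/
theorem exists_join_aux {w : Perm α} {p q r s : α} (ht : Le (swap r s) w) (hrs : r ≠ s)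
    (h1 : Same (w * swap r s) p r) (h2 : Same (w * swap r s) q s) :
    Le (swap p r * (swap q s * swap r s)) w ∧
    Le (swap p q) (swap p r * (swap q s * swap r s)) ∧
    Le (swap r s) (swap p r * (swap q s * swap r s)) := by
  have h3 : ¬ Same (w * swap r s) p q := fun h =>
    not_same_mul_swap hrs ht (h1.symm.trans (h.trans h2))
  obtain ⟨h4, h5⟩ := swap_mul_swap_le ht h2
  have h6 := same_mul_swap_of_not_same h1 h2 h3
  have h7 : Le (swap p r) (w * (swap q s * swap r s)⁻¹) := by
    rw [mul_inv_rev, swap_inv, swap_inv, ← mul_assoc]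
    exact swap_le_of_same h6
  obtain ⟨h8, h9⟩ := Le.of_le_div h5 h7
  refine ⟨h9, swap_le_of_same ?_, h4.trans h8⟩
  have h10 : Le (swap p r) (swap p r * (swap q s * swap r s)) := le_mul_iff'.2 (le_mul_iff.1 h8)
  have h11 : Le (swap q s) (swap q s * swap r s) := le_mul_iff'.2 (le_mul_iff.1 h4)
  exact (h10.same (same_swap p r)).trans (((h4.trans h8).same (same_swap r s)).trans
    ((h11.trans h8).same (same_swap q s)).symm)

/-- The position of `p, q` relative to `r, s` after removing `(r s)` must be of the same kind in `w`
and in `w'`: a mixed case would connect `r` and `s` in `c * swap r s`. This is the role of the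
common bound `c`, and in the remaining cases the same `d` serves both. -/
theorem exists_join {c w w' : Perm α} (hw : Le w c) (hw' : Le w' c) {p q r s : α} (hrs : r ≠ s)
    (h1 : Le (swap p q) w) (h2 : Le (swap p q) w') (h3 : Le (swap r s) w)
    (h4 : Le (swap r s) w') :
    ∃ d, Le d w ∧ Le d w' ∧ Le (swap p q) d ∧ Le (swap r s) d := by
  have hc := not_same_mul_swap hrs (h3.trans hw)
  have m : ∀ {v : Perm α}, Le v c → Le (swap r s) v → ∀ {x y : α}, Same (v * swap r s) x y →
      Same (c * swap r s) x y := by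
    intro v hv hs x y h
    have := Le.div_mono hs hv
    rw [swap_inv] at this
    exact this.same h
  have hsr : swap r s = swap s r := swap_comm r s
  rcases same_mul_swap_cases (r := r) (s := s) (swap_le_iff.1 h1) with a | ⟨a, b⟩ | ⟨a, b⟩ <;>
  rcases same_mul_swap_cases (r := r) (s := s) (swap_le_iff.1 h2) with a' | ⟨a', b'⟩ | ⟨a', b'⟩
  · obtain ⟨h5, h6⟩ := swap_mul_swap_le h3 a
    exact ⟨_, h6, (swap_mul_swap_le h4 a').2, le_mul_iff'.2 (le_mul_iff.1 h5), h5⟩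
  · exact absurd ((m hw' h4 a').symm.trans ((m hw h3 a).trans (m hw' h4 b'))) hc
  · exact absurd ((m hw' h4 b').symm.trans ((m hw h3 a).symm.trans (m hw' h4 a'))) hc
  · exact absurd ((m hw h3 a).symm.trans ((m hw' h4 a').trans (m hw h3 b))) hc
  · obtain ⟨h5, h6, h7⟩ := exists_join_aux h3 hrs a b
    exact ⟨_, h5, (exists_join_aux h4 hrs a' b').1, h6, h7⟩
  · exact absurd ((m hw h3 a).symm.trans (m hw' h4 a')) hc
  · exact absurd ((m hw h3 b).symm.trans ((m hw' h4 a').symm.trans (m hw h3 a))) hc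
  · exact absurd ((m hw' h4 a').symm.trans (m hw h3 a)) hc
  · rw [hsr] at h3 h4 a b a' b' ⊢
    obtain ⟨h5, h6, h7⟩ := exists_join_aux h3 hrs.symm a b
    exact ⟨_, h5, (exists_join_aux h4 hrs.symm a' b').1, h6, h7⟩

/-- Two elements above a common transposition are handled by dividing it out and using induction. In
general, take transpositions below `x` and below `y`, bound them by `d`, interpolate for `x` and
`d`, then for `y` and the result. -/
theorem exists_between {c : Perm α} : ∀ (k : ℕ) {w w' x y : Perm α}, len w = k → Le w c → Le w' c →
    Le x w → Le x w' → Le y w → Le y w' → ∃ z, Le x z ∧ Le y z ∧ Le z w ∧ Le z w' := by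
  intro k
  induction k with
  | zero =>
    intro w w' x y hk _ _ h1 h2 h3 h4
    rw [len_eq_zero] at hk
    subst hk
    obtain rfl := eq_one_of_le_one h1
    exact ⟨y, one_le y, Le.refl y, h3, h4⟩
  | succ k ih =>
    intro w w' x y hk hw hw' h1 h2 h3 h4
    by_cases hx : x = 1
    · subst hx
      exact ⟨y, one_le y, Le.refl y, h3, h4⟩
    by_cases hy : y = 1
    · subst hy
      exact ⟨x, Le.refl x, one_le x, h1, h2⟩
    obtain ⟨p, q, hpq, hs⟩ := exists_swap_le hx
    obtain ⟨r, s, hrs, ht⟩ := exists_swap_le hy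
    obtain ⟨d, d1, d2, d3, d4⟩ := exists_join hw hw' hrs (hs.trans h1) (hs.trans h2) (ht.trans h3)
      (ht.trans h4)
    have div : ∀ {p q : α} {x y : Perm α}, p ≠ q → Le (swap p q) x → Le (swap p q) y → Le x w →
        Le x w' → Le y w → Le y w' → ∃ z, Le x z ∧ Le y z ∧ Le z w ∧ Le z w' := by
      intro p q x y hpq e1 e2 f1 f2 f3 f4
      have g1 := e1.trans f1
      have g2 := e1.trans f2
      obtain ⟨z, z1, z2, z3, z4⟩ := ih (w := w * (swap p q)⁻¹) (w' := w' * (swap p q)⁻¹)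
        (x := x * (swap p q)⁻¹) (y := y * (swap p q)⁻¹)
        (by have := len_swap hpq; unfold Le at g1; omega) (g1.div_le.trans hw)
        (g2.div_le.trans hw') (e1.div_mono f1) (e1.div_mono f2) (e2.div_mono f3) (e2.div_mono f4)
      obtain ⟨u1, u2⟩ := Le.of_le_div g1 z3
      obtain ⟨-, u3⟩ := Le.of_le_div g2 z4
      refine ⟨z * swap p q, Le.of_div_le_div u1 ?_, Le.of_div_le_div u1 ?_, u2, u3⟩
      · rwa [mul_inv_cancel_right]
      · rwa [mul_inv_cancel_right]
    obtain ⟨z, z1, z2, z3, z4⟩ := div hpq hs d3 h1 h2 d1 d2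
    obtain ⟨z', y1, y2, y3, y4⟩ := div hrs ht (d4.trans z2) h3 h4 z3 z4
    exact ⟨z', z1.trans y2, y1, y3, y4⟩

/-- A common lower bound of maximal length absorbs every other one, since `exists_between` bounds
the two by a third. -/
theorem exists_inf {c u v : Perm α} (hu : Le u c) (hv : Le v c) :
    ∃ m, Le m u ∧ Le m v ∧ ∀ x, Le x u → Le x v → Le x m := by
  obtain ⟨m, ⟨h1, h2⟩, h3⟩ := Set.exists_max_image {m : Perm α | Le m u ∧ Le m v} len
    (Set.toFinite _) ⟨1, one_le u, one_le v⟩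
  refine ⟨m, h1, h2, fun x hx hx' => ?_⟩
  obtain ⟨z, z1, z2, z3, z4⟩ := exists_between _ rfl hu hv h1 h2 hx hx'
  rwa [z1.eq_of_len (h3 z ⟨z3, z4⟩)]

open Classical in
/-- The greatest lower bound of two elements of the interval below `c`. -/
noncomputable def inf (c u v : Perm α) : Perm α :=
  if h : Le u c ∧ Le v c then (exists_inf h.1 h.2).choose else 1

theorem inf_spec {c u v : Perm α} (hu : Le u c) (hv : Le v c) :
    Le (inf c u v) u ∧ Le (inf c u v) v ∧ ∀ x, Le x u → Le x v → Le x (inf c u v) := by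
  unfold inf
  rw [dif_pos ⟨hu, hv⟩]
  exact (exists_inf hu hv).choose_spec

end AbsOrder

end

/-! ### Right multiplication of greedy normal sequences by simple elements -/

section

open Equiv Module

namespace AbsOrder

variable {α : Type*} [Fintype α] [DecidableEq α]

/-- The right greedy normal sequences of elements of the interval below `c`. -/
structure NormalSeq (c : Perm α) where
  seq : ℕ → Perm α
  le : ∀ k, Le (seq k) c
  -- The sequence is read from right to left: no nontrivial right factor of the next term can be
  -- moved into the term on its right while keeping that term below `c`.
  normal : ∀ k y, Le y (seq (k + 1)) → Le y (c * (seq k)⁻¹) → y = 1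

theorem NormalSeq.ext {c : Perm α} {U V : NormalSeq c} (h : ∀ k, U.seq k = V.seq k) : U = V := by
  obtain ⟨u, _, _⟩ := U
  obtain ⟨v, _, _⟩ := V
  obtain rfl : u = v := funext h
  rfl

/-- The largest right divisor of `u` whose product with `s` is below `c`. -/
noncomputable def absorbed (c u s : Perm α) : Perm α := inf c u (c * s⁻¹)

/-- The sequence of carries when a sequence is multiplied by `s` on the right. -/
noncomputable def carry (c : Perm α) (u : ℕ → Perm α) (s : Perm α) : ℕ → Perm α
  | 0 => s
  | k + 1 => u k * (absorbed c (u k) (carry c u s k))⁻¹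

variable {c : Perm α}

theorem absorbed_le {u s : Perm α} (hu : Le u c) (hs : Le s c) : Le (absorbed c u s) u :=
  (inf_spec hu hs.div_le).1

theorem absorbed_le_div {u s : Perm α} (hu : Le u c) (hs : Le s c) :
    Le (absorbed c u s) (c * s⁻¹) :=
  (inf_spec hu hs.div_le).2.1

theorem le_absorbed {u s x : Perm α} (hu : Le u c) (hs : Le s c) (h1 : Le x u)
    (h2 : Le x (c * s⁻¹)) : Le x (absorbed c u s) :=
  (inf_spec hu hs.div_le).2.2 x h1 h2

theorem le_absorbed_mul {u s : Perm α} (hu : Le u c) (hs : Le s c) :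
    Le s (absorbed c u s * s) ∧ Le (absorbed c u s * s) c :=
  Le.of_le_div hs (absorbed_le_div hu hs)

theorem absorbed_eq_of_le {u s : Perm α} (hu : Le u c) (hs : Le s c) (h : Le u (c * s⁻¹)) :
    absorbed c u s = u :=
  (absorbed_le hu hs).antisymm (le_absorbed hu hs (Le.refl u) h)

theorem carry_le {u : ℕ → Perm α} (hu : ∀ k, Le (u k) c) {s : Perm α} (hs : Le s c) (k : ℕ) :
    Le (carry c u s k) c := by
  induction k with
  | zero => exact hs
  | succ k ih => exact (absorbed_le (hu k) ih).div_le.trans (hu k)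

/-- Let `x` be the part of `u₀` absorbed by `r₀`, and let `m` be the meet of the new second term
with `c * x⁻¹`. Normality of the old pair forces `m = u₀ * x⁻¹`. So `y` is a factor of `u₀ * x⁻¹`,
the product `y * x` is a factor of `u₀` that could be absorbed, and maximality of `x` gives `y = 1`.
-/
theorem normal_step {u₀ u₁ r₀ y : Perm α} (h0 : Le u₀ c) (h1 : Le u₁ c) (hr : Le r₀ c)
    (hn : ∀ y, Le y u₁ → Le y (c * u₀⁻¹) → y = 1)
    (hy : Le y (absorbed c u₁ (u₀ * (absorbed c u₀ r₀)⁻¹) * (u₀ * (absorbed c u₀ r₀)⁻¹)))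
    (hy' : Le y (c * (absorbed c u₀ r₀ * r₀)⁻¹)) : y = 1 := by
  have hx := absorbed_le h0 hr
  obtain ⟨hx1, hx2⟩ := le_absorbed_mul h0 hr
  set x := absorbed c u₀ r₀ with hxdef
  have hr1 : Le (u₀ * x⁻¹) c := hx.div_le.trans h0
  obtain ⟨hz1, hz2⟩ := le_absorbed_mul h1 hr1
  have hz3 := absorbed_le h1 hr1
  set z := absorbed c u₁ (u₀ * x⁻¹) with hzdef
  obtain ⟨g1, g2⟩ := Le.of_le_div hx2 hy'
  have g3 : Le (y * x) (c * r₀⁻¹) := by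
    apply Le.le_div _ (by rwa [mul_assoc])
    rw [mul_assoc]
    exact hx1.trans g1
  have g4 : Le x (y * x) := by
    rw [le_mul_iff, ← le_mul_iff']
    have h5 : Le y (y * (x * r₀)) := le_mul_iff'.2 (le_mul_iff.1 g1)
    have h6 := le_mul_iff.1 g1
    have h7 := le_mul_iff.1 hx1
    have h8 := len_mul_le (y * x) r₀
    have h9 := len_mul_le y x
    rw [mul_assoc] at h8
    rw [le_mul_iff']
    omega
  have g5 : Le y (c * x⁻¹) := Le.le_div g4 (g3.trans hr.div_le)
  have g6 : Le (u₀ * x⁻¹) (c * x⁻¹) := hx.div_mono h0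
  obtain ⟨m1, m2, m3⟩ := inf_spec (c := c) hz2 (hx.trans h0).div_le
  set m := inf c (z * (u₀ * x⁻¹)) (c * x⁻¹) with hm
  have m4 := m3 _ hz1 g6
  have m5 := m3 _ hy g5
  have m6 : m * (u₀ * x⁻¹)⁻¹ = 1 := by
    apply hn
    · refine Le.trans ?_ hz3
      have := m4.div_mono m1
      rwa [mul_inv_cancel_right] at this
    · have := m4.div_mono m2
      rwa [show c * x⁻¹ * (u₀ * x⁻¹)⁻¹ = c * u₀⁻¹ by group] at this
  rw [mul_inv_eq_one] at m6
  rw [m6] at m5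
  obtain ⟨-, g7⟩ := Le.of_le_div hx m5
  have g8 := le_absorbed h0 hr g7 g3
  rw [← hxdef] at g8
  have := g4.antisymm g8
  simpa using this

/-- Right multiplication of a normal sequence by an element below `c`. -/
noncomputable def act (U : NormalSeq c) (s : Perm α) (hs : Le s c) : NormalSeq c where
  seq k := absorbed c (U.seq k) (carry c U.seq s k) * carry c U.seq s k
  le k := (le_absorbed_mul (U.le k) (carry_le U.le hs k)).2
  normal k _ h1 h2 := normal_step (U.le k) (U.le (k + 1)) (carry_le U.le hs k) (U.normal k) h1 h2

/-- The local fact is that absorbing `r * q` at once agrees with absorbing `r` first and then `q`;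
it is iterated along the carries. -/
theorem carry_mul (U : NormalSeq c) {s t : Perm α} (h1 : Le s (t * s)) (h2 : Le (t * s) c)
    (ht : Le t c) (k : ℕ) :
    carry c U.seq (t * s) k = carry c U.seq t k * carry c (act U t ht).seq s k ∧
    Le (carry c (act U t ht).seq s k) (carry c U.seq (t * s) k) ∧
    absorbed c (U.seq k) (carry c U.seq (t * s) k) * carry c U.seq t k =
      absorbed c ((act U t ht).seq k) (carry c (act U t ht).seq s k) := by
  have key : ∀ {u r q : Perm α}, Le u c → Le q (r * q) → Le (r * q) c →
      Le (absorbed c u (r * q)) (absorbed c u r) ∧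
      absorbed c u (r * q) * r = absorbed c (absorbed c u r * r) q := by
    intro u r q hu g1 g2
    have hq : Le q c := g1.trans g2
    have hr : Le r c := (le_mul_iff'.2 (le_mul_iff.1 g1)).trans g2
    have z1 := absorbed_le hu g2
    obtain ⟨z2, z3⟩ := le_absorbed_mul hu g2
    have lz := le_mul_iff.1 z2
    have lrq := le_mul_iff.1 g1
    have l1 := len_mul_le (absorbed c u (r * q) * r) q
    have l2 := len_mul_le (absorbed c u (r * q)) r
    rw [mul_assoc] at l1
    have z4 : Le r (absorbed c u (r * q) * r) := le_mul_iff.2 (by omega)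
    have z5 : Le q (absorbed c u (r * q) * r * q) := le_mul_iff.2 (by rw [mul_assoc]; omega)
    have z6 : Le (absorbed c u (r * q) * r) (c * q⁻¹) := by
      apply Le.le_div z5
      rwa [mul_assoc]
    have z7 : Le (absorbed c u (r * q)) (c * r⁻¹) := z4.le_div (z6.trans hq.div_le)
    have z8 := le_absorbed hu hr z1 z7
    refine ⟨z8, ?_⟩
    obtain ⟨x1, x2⟩ := le_absorbed_mul hu hr
    have z9 : Le (absorbed c u (r * q) * r) (absorbed c u r * r) :=
      Le.of_div_le_div x1 (by simpa using z8)
    apply Le.antisymm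
    · exact le_absorbed x2 hq z9 z6
    · have y1 : Le r (c * q⁻¹) := g1.le_div g2
      have y2 := le_absorbed x2 hq x1 y1
      have y3 := absorbed_le x2 hq
      have y4 := absorbed_le_div x2 hq
      have w1 : Le (absorbed c (absorbed c u r * r) q * r⁻¹) (absorbed c u r) := by
        have := y2.div_mono y3
        rwa [mul_inv_cancel_right] at this
      have w2 : Le (absorbed c (absorbed c u r * r) q * r⁻¹) (c * (r * q)⁻¹) := by
        have := y2.div_mono y4
        rwa [show c * q⁻¹ * r⁻¹ = c * (r * q)⁻¹ by group] at this
      have w3 := le_absorbed hu g2 (w1.trans (absorbed_le hu hr)) w2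
      exact Le.of_div_le_div z4 (by rwa [mul_inv_cancel_right])
  have main : carry c U.seq (t * s) k = carry c U.seq t k * carry c (act U t ht).seq s k ∧
    Le (carry c (act U t ht).seq s k) (carry c U.seq (t * s) k) := by
    induction k with
    | zero => exact ⟨rfl, h1⟩
    | succ k ih =>
      obtain ⟨e1, e2⟩ := ih
      have e3 := carry_le U.le h2 k
      rw [e1] at e2 e3
      obtain ⟨k1, k2⟩ := key (U.le k) e2 e3
      have e4 : carry c (act U t ht).seq s (k + 1) =
          absorbed c (U.seq k) (carry c U.seq t k) *
            (absorbed c (U.seq k) (carry c U.seq (t * s) k))⁻¹ := by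
        rw [carry, e1]
        change absorbed c (U.seq k) (carry c U.seq t k) * carry c U.seq t k *
          (absorbed c (absorbed c (U.seq k) (carry c U.seq t k) * carry c U.seq t k) _)⁻¹ = _
        rw [← k2]
        group
      rw [e4]
      constructor
      · simp only [carry]
        group
      · rw [carry, e1]
        exact k1.div_mono (absorbed_le (U.le k) (carry_le U.le ht k))
  refine ⟨main.1, main.2, ?_⟩
  obtain ⟨e1, e2⟩ := main
  have e3 := carry_le U.le h2 k
  rw [e1] at e2 e3
  rw [e1]
  exact (key (U.le k) e2 e3).2

theorem act_mul (U : NormalSeq c) {s t : Perm α} (h1 : Le s (t * s)) (h2 : Le (t * s) c)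
    (ht : Le t c) (hs : Le s c) : act (act U t ht) s hs = act U (t * s) h2 := by
  apply NormalSeq.ext
  intro k
  obtain ⟨e1, -, e3⟩ := carry_mul U h1 h2 ht k
  simp only [act] at e1 e3 ⊢
  rw [← e3, mul_assoc, ← e1]

/-- Nothing can be absorbed into `c`, so the first carry out is the whole rightmost term; by
normality that term absorbs nothing from the next one, and so on. -/
theorem act_top_seq (U : NormalSeq c) (k : ℕ) :
    (act U c (Le.refl c)).seq (k + 1) = U.seq k := by
  have h1 : ∀ k, carry c U.seq c (k + 1) = U.seq k := by
    intro k
    induction k with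
    | zero =>
      have h := absorbed_le_div (U.le 0) (Le.refl c)
      rw [mul_inv_cancel] at h
      rw [carry, carry, eq_one_of_le_one h, inv_one, mul_one]
    | succ k ih =>
      have h : absorbed c (U.seq (k + 1)) (U.seq k) = 1 :=
        U.normal k _ (absorbed_le (U.le _) (U.le _)) (absorbed_le_div (U.le _) (U.le _))
      rw [carry, ih, h, inv_one, mul_one]
  have h : absorbed c (U.seq (k + 1)) (U.seq k) = 1 :=
    U.normal k _ (absorbed_le (U.le _) (U.le _)) (absorbed_le_div (U.le _) (U.le _))
  simp only [act]
  rw [h1, h, one_mul]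

theorem act_top_injective :
    Function.Injective fun U : NormalSeq c => act U c (Le.refl c) := by
  intro U V h
  apply NormalSeq.ext
  intro k
  rw [← act_top_seq U, ← act_top_seq V]
  exact congrArg (fun W => W.seq (k + 1)) h

theorem act_act_div (U : NormalSeq c) {s : Perm α} (hs : Le s c) :
    act (act U (c * s⁻¹) hs.div_le) s hs = act U c (Le.refl c) := by
  rw [act_mul U (by rwa [inv_mul_cancel_right]) (by rw [inv_mul_cancel_right]; exact Le.refl c)]
  congr 1
  group

theorem act_act_ldiv (U : NormalSeq c) {s : Perm α} (hs : Le s c) :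
    act (act U s hs) (s⁻¹ * c) hs.ldiv_le = act U c (Le.refl c) := by
  rw [act_mul U (by rw [mul_inv_cancel_left]; exact hs.ldiv_le)
    (by rw [mul_inv_cancel_left]; exact Le.refl c)]
  congr 1
  group

theorem Le.conj_top {s : Perm α} (hs : Le s c) : Le (c * s * c⁻¹) c := by
  have := hs.div_le.div_le
  rwa [show c * (c * s⁻¹)⁻¹ = c * s * c⁻¹ by group] at this

/-- Both sides are obtained by completing factors to `c`: the identity `c s = (c s c⁻¹) c` uses only
products of simple elements that are again simple. -/
theorem act_top_act (U : NormalSeq c) {s : Perm α} (hs : Le s c) :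
    act (act U c (Le.refl c)) s hs = act (act U (c * s * c⁻¹) hs.conj_top) c (Le.refl c) := by
  rw [← act_act_div (act U (c * s * c⁻¹) hs.conj_top) hs]
  congr 1
  have h := act_act_ldiv U hs.conj_top
  rw [← h]
  congr 1
  group

theorem act_congr (U : NormalSeq c) {s t : Perm α} (h : s = t) (hs : Le s c) (ht : Le t c) :
    act U s hs = act U t ht := by
  subst h
  rfl

/-- Multiplication of normal sequences by the central power `c ^ orderOf c`. -/
noncomputable def actCentral (U : NormalSeq c) : NormalSeq c :=
  (fun V => act V c (Le.refl c))^[orderOf c] U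

theorem actCentral_injective : Function.Injective (actCentral (c := c)) :=
  act_top_injective.iterate _

theorem Le.conj_top_pow {s : Perm α} (hs : Le s c) (k : ℕ) : Le (c ^ k * s * (c ^ k)⁻¹) c := by
  induction k with
  | zero => simpa using hs
  | succ k ih =>
    have := ih.conj_top
    rwa [show c * (c ^ k * s * (c ^ k)⁻¹) * c⁻¹ = c ^ (k + 1) * s * (c ^ (k + 1))⁻¹ by
      rw [pow_succ']; group] at this

/-- Moving `s` past each factor `c` conjugates it by `c`; after `orderOf c` factors the permutation
`s` returns to itself. -/
theorem act_actCentral (U : NormalSeq c) {s : Perm α} (hs : Le s c) :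
    act (actCentral U) s hs = actCentral (act U s hs) := by
  have h : ∀ k : ℕ, act ((fun V => act V c (Le.refl c))^[k] U) s hs =
      (fun V => act V c (Le.refl c))^[k] (act U (c ^ k * s * (c ^ k)⁻¹) (hs.conj_top_pow k)) := by
    intro k
    induction k generalizing s with
    | zero =>
      simp only [Function.iterate_zero, id]
      exact act_congr U (by simp) _ _
    | succ k ih =>
      rw [Function.iterate_succ_apply', Function.iterate_succ_apply', act_top_act, ih]
      congr 2
      exact act_congr U (by rw [pow_succ]; group) _ _
  unfold actCentral
  rw [h]
  congr 1
  exact act_congr U (by simp [pow_orderOf_eq_one]) _ _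

end AbsOrder

end

/-! ### Fractions of normal sequences, and products along shortest factorizations -/

section

open Equiv Module

section Localization

variable {X : Type*} {D : X → X}

/-- The equivalence of formal fractions `D⁻ᵃ U` for an injective self-map `D`. -/
def locSetoid (hD : Function.Injective D) : Setoid (ℕ × X) where
  r x y := D^[y.1] x.2 = D^[x.1] y.2
  iseqv :=
    { refl := fun _ => rfl
      symm := fun h => h.symm
      trans := by
        rintro ⟨a, U⟩ ⟨b, V⟩ ⟨d, W⟩ h1 h2
        simp only at h1 h2 ⊢
        apply hD.iterate b
        rw [← Function.iterate_add_apply, add_comm, Function.iterate_add_apply, h1,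
          ← Function.iterate_add_apply, add_comm, Function.iterate_add_apply, h2,
          ← Function.iterate_add_apply, add_comm, Function.iterate_add_apply] }

/-- The set of formal fractions `D⁻ᵃ U`, on which `D` becomes bijective. -/
def Loc (hD : Function.Injective D) : Type _ := Quotient (locSetoid hD)

variable (hD : Function.Injective D)

/-- The embedding of a set into its set of formal fractions. -/
def Loc.of (U : X) : Loc hD := Quotient.mk (locSetoid hD) (0, U)

theorem Loc.of_injective : Function.Injective (Loc.of hD) := fun _ _ h => Quotient.exact h

/-- The extension to formal fractions of a map that commutes with `D`. -/
def Loc.map (f : X → X) (hf : Function.Commute f D) : Loc hD → Loc hD :=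
  Quotient.map (fun x => (x.1, f x.2)) (by
    rintro ⟨a, U⟩ ⟨b, V⟩ (h : D^[b] U = D^[a] V)
    change D^[b] (f U) = D^[a] (f V)
    rw [← (hf.iterate_right b).eq, ← (hf.iterate_right a).eq, h])

theorem Loc.map_bijective (f : X → X) (hf : Function.Commute f D) (hinj : Function.Injective f)
    (hsurj : ∀ V, ∃ U, f U = D V) : Function.Bijective (Loc.map hD f hf) := by
  constructor
  · intro x y
    refine Quotient.inductionOn₂ x y ?_
    rintro ⟨a, U⟩ ⟨b, V⟩ h
    refine Quotient.sound (s := locSetoid hD) ?_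
    have h1 : D^[b] (f U) = D^[a] (f V) := Quotient.exact h
    rw [← (hf.iterate_right b).eq, ← (hf.iterate_right a).eq] at h1
    exact hinj h1
  · intro y
    refine Quotient.inductionOn y ?_
    rintro ⟨a, V⟩
    obtain ⟨U, hU⟩ := hsurj V
    refine ⟨Quotient.mk (locSetoid hD) (a + 1, U), Quotient.sound (s := locSetoid hD) ?_⟩
    change D^[a] (f U) = D^[a + 1] V
    rw [hU, Function.iterate_succ_apply]

end Localization

namespace AbsOrder

variable {α : Type*} [Fintype α] [DecidableEq α] {c : Perm α}

/-- The formal fractions of normal sequences. -/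
abbrev FracSeq (c : Perm α) : Type _ := Loc (actCentral_injective (c := c))

theorem act_injective {s : Perm α} (hs : Le s c) :
    Function.Injective fun U : NormalSeq c => act U s hs := by
  intro U V h
  apply act_top_injective
  have := congrArg (fun W => act W _ hs.ldiv_le) h
  simpa only [act_act_ldiv] using this

/-- The permutation of the set of fractions that multiplies by `s` on the right. -/
noncomputable def fracAct (s : Perm α) (hs : Le s c) : Perm (FracSeq c) :=
  Equiv.ofBijective (Loc.map actCentral_injective (fun U => act U s hs)
    fun U => act_actCentral U hs) (Loc.map_bijective _ _ _ (act_injective hs) (by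
      intro V
      -- The last of the `orderOf c` factors `c` is written as `(c s⁻¹) s`, so stopping before `s`
      -- gives a preimage.
      refine ⟨act ((fun V => act V c (Le.refl c))^[orderOf c - 1] V) (c * s⁻¹) hs.div_le, ?_⟩
      rw [act_act_div]
      unfold actCentral
      have h : orderOf c = orderOf c - 1 + 1 := by
        have := orderOf_pos c
        omega
      conv_rhs => rw [h]
      rw [Function.iterate_succ_apply']))

theorem fracAct_of (s : Perm α) (hs : Le s c) (U : NormalSeq c) :
    fracAct s hs (Loc.of _ U) = Loc.of _ (act U s hs) := rfl

theorem fracAct_mul {s t : Perm α} (h1 : Le s (t * s)) (h2 : Le (t * s) c) (ht : Le t c)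
    (hs : Le s c) : fracAct s hs * fracAct t ht = fracAct (t * s) h2 := by
  ext x
  refine Quotient.inductionOn x ?_
  rintro ⟨a, U⟩
  have := act_mul U h1 h2 ht hs
  exact congrArg (fun V => Quotient.mk (locSetoid actCentral_injective) (a, V)) this

/-- The constant sequence `1`. -/
def NormalSeq.one (c : Perm α) : NormalSeq c where
  seq _ := 1
  le _ := one_le c
  normal _ _ h _ := eq_one_of_le_one h

section Lift

variable {G : Type*} [Monoid G] (A : α → α → G)

/-- `IsLift A w b`: the element `b` is the product of the `A p q` along a decomposition of the
permutation `w` into the smallest possible number of transpositions `(p q)`. -/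
inductive IsLift : Perm α → G → Prop
  | one : IsLift 1 1
  | mul_swap {w : Perm α} {b : G} (p q : α) (hpq : p ≠ q) (h : IsLift w b)
      (hl : Le (swap p q) (w * swap p q)) : IsLift (w * swap p q) (b * A p q)

theorem exists_isLift (w : Perm α) : ∃ b, IsLift A w b := by
  induction h : len w using Nat.strong_induction_on generalizing w with
  | _ k ih =>
    by_cases hw : w = 1
    · subst hw
      exact ⟨1, IsLift.one⟩
    · obtain ⟨p, q, hpq, hs⟩ := exists_swap_le hw
      obtain ⟨b, hb⟩ := ih _ (by have := len_swap hpq; unfold Le at hs; omega)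
        (w * (swap p q)⁻¹) rfl
      have := IsLift.mul_swap p q hpq hb
      rw [inv_mul_cancel_right] at this
      exact ⟨_, this hs⟩

variable {A}

theorem IsLift.mul {y z : Perm α} {b b' : G} (hz : IsLift A z b') (hy : IsLift A y b)
    (h : Le z (y * z)) : IsLift A (y * z) (b * b') := by
  induction hz with
  | one => simpa using hy
  | @mul_swap w b' p q hpq hw hl ih =>
    have l1 := le_mul_iff.1 hl
    have l2 := le_mul_iff.1 h
    have l3 := len_mul_le (y * w) (swap p q)
    have l4 := len_mul_le y w
    rw [mul_assoc] at l3
    rw [← mul_assoc, ← mul_assoc]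
    exact IsLift.mul_swap p q hpq (ih (le_mul_iff.2 (by omega)))
      (le_mul_iff.2 (by rw [mul_assoc]; omega))

theorem isLift_swap {p q : α} (h : p ≠ q) : IsLift A (swap p q) (A p q) := by
  have := IsLift.mul_swap (A := A) p q h IsLift.one
  simp only [one_mul] at this
  exact this (Le.refl _)

theorem IsLift.mem {w : Perm α} {b : G} (h : IsLift A w b) {K : Submonoid G} {c' : Perm α}
    (hw : Le w c') (hK : ∀ p q, p ≠ q → Le (swap p q) c' → A p q ∈ K) : b ∈ K := by
  induction h with
  | one => exact K.one_mem
  | mul_swap p q hpq h hl ih =>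
    refine K.mul_mem (ih ((le_mul_iff'.2 (le_mul_iff.1 hl)).trans hw)) (hK p q hpq (hl.trans hw))

/-- The Hurwitz relations between the atoms `A p q` whose product is simple with respect to `c`. -/
structure HurwitzRel (c : Perm α) (A : α → α → G) : Prop where
  comm : ∀ p q, A p q = A q p
  rel : ∀ p q r s, p ≠ q → r ≠ s → Le (swap r s) (swap p q * swap r s) →
    Le (swap p q * swap r s) c →
    A p q * A r s = A (swap p q r) (swap p q s) * A p q

theorem IsLift.eq_one_or {w : Perm α} {b : G} (h : IsLift A w b) : (w = 1 ∧ b = 1) ∨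
    ∃ p q x, p ≠ q ∧ Le (swap p q) w ∧ IsLift A (w * swap p q) x ∧ b = x * A p q := by
  cases h with
  | one => exact Or.inl ⟨rfl, rfl⟩
  | @mul_swap w x p q hpq h hl =>
    refine Or.inr ⟨p, q, x, hpq, hl, ?_, rfl⟩
    rwa [mul_assoc, swap_mul_self, mul_one]

/-- A Matsumoto-type property: any two shortest factorizations are linked by Hurwitz moves. By
induction on length it suffices to compare the last factors `(p q)` and `(r s)`. -/
theorem IsLift.unique (hA : HurwitzRel c A) {w : Perm α} (hw : Le w c) {b b' : G}
    (h : IsLift A w b) (h' : IsLift A w b') : b = b' := by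
  induction hk : len w using Nat.strong_induction_on generalizing w b b' with
  | _ k ih =>
    -- Here `(p q)(r s)` is a shortest right factor of `w`, and one Hurwitz move makes `(p q)` the
    -- last letter.
    have step1 : ∀ {p q r s : α} {x y : G}, p ≠ q → r ≠ s → Le (swap p q) w → Le (swap r s) w →
        Same (w * swap r s) p q → IsLift A (w * swap p q) x → IsLift A (w * swap r s) y →
        x * A p q = y * A r s := by
      intro p q r s x y hpq hrs hs ht h1 hx hy
      obtain ⟨e1, e2⟩ := swap_mul_swap_le ht h1
      have e3 : Le (swap p q) (swap p q * swap r s) := le_mul_iff'.2 (le_mul_iff.1 e1)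
      obtain ⟨z, hz⟩ := exists_isLift A (w * swap r s * swap p q)
      have e4 : Le (swap p q) (w * swap r s) := swap_le_of_same h1
      have l1 := len_swap hpq
      have l2 := len_swap hrs
      have l3 : len (w * swap p q) < k := by
        unfold Le at hs
        rw [swap_inv] at hs
        omega
      have l4 : len (w * swap r s) < k := by
        unfold Le at ht
        rw [swap_inv] at ht
        omega
      have hsw : Le (w * swap p q) c := by
        have := hs.div_le.trans hw
        rwa [swap_inv] at this
      have htw : Le (w * swap r s) c := by
        have := ht.div_le.trans hw
        rwa [swap_inv] at this
      have f1 := IsLift.mul_swap p q hpq hz (by rwa [mul_assoc, swap_mul_self, mul_one])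
      rw [mul_assoc (w * swap r s), swap_mul_self, mul_one] at f1
      have f2 := ih _ l4 htw hy f1 rfl
      have hconj : swap (swap p q r) (swap p q s) = swap p q * swap r s * swap p q := by
        have := swap_apply_apply (swap p q) r s
        rwa [swap_inv] at this
      have hne : swap p q r ≠ swap p q s := fun h => hrs ((swap p q).injective h)
      have e5 : w * swap r s * swap p q * swap (swap p q r) (swap p q s) = w * swap p q := by
        rw [hconj]
        simp only [mul_assoc]
        rw [← mul_assoc (swap p q) (swap p q), swap_mul_self, one_mul,
          ← mul_assoc (swap r s) (swap r s), swap_mul_self, one_mul]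
      have f3 := IsLift.mul_swap _ _ hne hz (by
        rw [le_mul_iff, e5, len_swap hne]
        unfold Le at hs ht e4
        rw [swap_inv] at hs ht e4
        omega)
      rw [e5] at f3
      have f4 := ih _ l3 hsw hx f3 rfl
      rw [f2, f4, mul_assoc, mul_assoc, hA.rel p q r s hpq hrs e1 (e2.trans hw)]
    -- For transpositions sharing a point, one of the two orders always satisfies the hypothesis of
    -- `step1`.
    have step2 : ∀ {p q s : α} {x y : G}, p ≠ q → p ≠ s → Le (swap p q) w → Le (swap p s) w →
        IsLift A (w * swap p q) x → IsLift A (w * swap p s) y → x * A p q = y * A p s := by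
      intro p q s x y hpq hps hs ht hx hy
      by_cases hqs : q = s
      · subst hqs
        rw [ih _ (by have := len_swap hpq; unfold Le at hs; rw [swap_inv] at hs; omega)
          (by have := hs.div_le.trans hw; rwa [swap_inv] at this) hx hy rfl]
      by_cases h1 : Same (w * swap p s) p q
      · exact step1 hpq hps hs ht h1 hx hy
      · refine (step1 hps hpq ht hs ?_ hy hx).symm
        have h2 : Same (w * swap p s) q s := by
          rcases same_mul_swap_cases (r := p) (s := s) (swap_le_iff.1 hs) with h2 | h2 | h2
          · exact absurd h2 h1
          · exact h2.2
          · exact absurd h2.1 (not_same_mul_swap hps ht)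
        obtain ⟨e1, e2⟩ := swap_mul_swap_le ht h2
        have e3 : swap q s * swap p s = swap p s * swap p q := by
          have := swap_apply_apply (swap p s) p q
          rw [swap_apply_left, swap_apply_of_ne_of_ne hpq.symm hqs, swap_inv] at this
          rw [swap_comm q s, this, mul_assoc, swap_mul_self, mul_one]
        have e4 := le_mul_iff.1 e1
        rw [e3] at e2 e4
        rw [len_swap hqs, len_swap hps] at e4
        have e5 : Le (swap p q) (swap p s * swap p q) :=
          le_mul_iff.2 (by rw [e4, len_swap hps, len_swap hpq])
        have e6 := e5.le_div e2
        rw [swap_inv] at e6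
        exact swap_le_iff.1 e6
    -- The transposition `(p r)` shares a point with each of the two, so `step2` applies twice.
    have step3 : ∀ {p q r s : α} {x y : G}, p ≠ q → r ≠ s → Le (swap p q) w → Le (swap r s) w →
        IsLift A (w * swap p q) x → IsLift A (w * swap r s) y →
        Same (w * swap r s) p r → x * A p q = y * A r s := by
      intro p q r s x y hpq hrs hs ht hx hy h1
      by_cases hpr : p = r
      · subst hpr
        exact step2 hpq hrs hs ht hx hy
      have h2 : Le (swap p r) w := by
        have := ht.div_le
        rw [swap_inv] at this
        exact swap_le_of_same (this.same h1)
      obtain ⟨z, hz⟩ := exists_isLift A (w * swap p r)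
      rw [step2 hpq hpr hs h2 hx hz, hA.comm p r]
      rw [swap_comm] at hz h2
      exact step2 (Ne.symm hpr) hrs h2 ht hz hy
    rcases h.eq_one_or with ⟨h1, h2⟩ | ⟨p, q, x, hpq, hs, hx, rfl⟩ <;>
    rcases h'.eq_one_or with ⟨h3, h4⟩ | ⟨r, s, y, hrs, ht, hy, rfl⟩
    · rw [h2, h4]
    · exact absurd (eq_one_of_le_one (h1 ▸ ht)) (mt swap_eq_one_iff.1 hrs)
    · exact absurd (eq_one_of_le_one (h3 ▸ hs)) (mt swap_eq_one_iff.1 hpq)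
    · rcases same_mul_swap_cases (r := r) (s := s) (swap_le_iff.1 hs) with h1 | h1 | h1
      · exact step1 hpq hrs hs ht h1 hx hy
      · exact step3 hpq hrs hs ht hx hy h1.1
      · rw [hA.comm r s]
        rw [swap_comm r s] at hy ht h1
        exact step3 hpq hrs.symm hs ht hx hy h1.1

variable (A) in
/-- The product of the `A p q` along a shortest decomposition of a permutation. -/
noncomputable def lift (w : Perm α) : G := (exists_isLift A w).choose

theorem isLift_lift (w : Perm α) : IsLift A w (lift A w) := (exists_isLift A w).choose_spec

theorem lift_mul (hA : HurwitzRel c A) {y z : Perm α} (h1 : Le z (y * z)) (h2 : Le (y * z) c) :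
    lift A (y * z) = lift A y * lift A z :=
  (isLift_lift _).unique hA h2 ((isLift_lift z).mul (isLift_lift y) h1)

theorem lift_swap (hA : HurwitzRel c A) {p q : α} (h : p ≠ q) (h1 : Le (swap p q) c) :
    lift A (swap p q) = A p q :=
  (isLift_lift _).unique hA h1 (isLift_swap h)

theorem lift_one (hA : HurwitzRel c A) : lift A (1 : Perm α) = 1 :=
  (isLift_lift _).unique hA (one_le c) IsLift.one

variable (A) in
/-- The product of the lifts of the first `m` terms of a sequence, read from right to left. -/
noncomputable def partialProd (u : ℕ → Perm α) : ℕ → G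
  | 0 => 1
  | m + 1 => lift A (u m) * partialProd u m

/-- Links the combinatorial action with multiplication in `G`: pushing `s` leftwards through `m`
terms rewrites them and leaves the carry in front. -/
theorem partialProd_mul_lift (hA : HurwitzRel c A) (U : NormalSeq c) {s : Perm α} (hs : Le s c)
    (m : ℕ) : partialProd A U.seq m * lift A s =
      lift A (carry c U.seq s m) * partialProd A (act U s hs).seq m := by
  induction m with
  | zero => simp [partialProd, carry]
  | succ m ih =>
    have h1 := carry_le U.le hs m
    have h2 := absorbed_le (U.le m) h1
    have h3 : lift A (U.seq m) = lift A (carry c U.seq s (m + 1)) *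
        lift A (absorbed c (U.seq m) (carry c U.seq s m)) := by
      rw [← lift_mul hA, carry, inv_mul_cancel_right]
      · rw [carry, inv_mul_cancel_right]
        exact h2
      · rw [carry, inv_mul_cancel_right]
        exact U.le m
    obtain ⟨h4, h5⟩ := le_absorbed_mul (U.le m) h1
    have h6 : lift A ((act U s hs).seq m) = lift A (absorbed c (U.seq m) (carry c U.seq s m)) *
        lift A (carry c U.seq s m) := lift_mul hA h4 h5
    rw [partialProd, partialProd, mul_assoc, ih, h3, h6]
    simp only [mul_assoc]

theorem carry_eq_one {U : NormalSeq c} {m : ℕ} (hU : U.seq m = 1) (s : Perm α) (hs : Le s c) :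
    carry c U.seq s (m + 1) = 1 := by
  rw [carry, hU]
  have := absorbed_le (U.le m) (carry_le U.le hs m)
  rw [hU] at this
  rw [eq_one_of_le_one this, inv_one, mul_one]

end Lift

end AbsOrder

end

/-! ### Relations between the Birman-Ko-Lee generators, and their rotation -/

namespace ArtinBraid

variable {n : ℕ}

theorem commute_sigma {i j : ℕ} (h : i + 2 ≤ j) : Commute (sigma n i) (sigma n j) := by
  by_cases hi : 1 ≤ i
  · by_cases hj : j < n
    · exact sigma_comm n hi h hj
    · have : sigma n j = 1 := dif_neg (by omega)
      rw [this]
      exact Commute.one_right _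
  · have : sigma n i = 1 := dif_neg (by omega)
    rw [this]
    exact Commute.one_left _

theorem delta_self (p : ℕ) : delta n p p = 1 := by simp [delta]

theorem delta_mul {p q r : ℕ} (h1 : p ≤ q) (h2 : q ≤ r) :
    delta n p q * delta n q r = delta n p r := by
  have := List.range'_append_1 (s := p) (m := q - p) (n := r - q)
  rw [show p + (q - p) = q by omega, show q - p + (r - q) = r - p by omega] at this
  simp only [delta]
  rw [← this, List.map_append, List.prod_append]

theorem delta_succ_self (p : ℕ) : delta n p (p + 1) = sigma n p := by simp [delta]

theorem delta_succ {p q : ℕ} (h : p ≤ q) : delta n p (q + 1) = delta n p q * sigma n q := by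
  rw [← delta_mul h (Nat.le_succ q), delta_succ_self]

theorem delta_eq_sigma_mul {p q : ℕ} (h : p < q) :
    delta n p q = sigma n p * delta n (p + 1) q := by
  rw [← delta_mul (Nat.le_succ p) h, delta_succ_self]

theorem a_succ (p q : ℕ) : a n p (q + 1) = delta n p q * sigma n q * (delta n p q)⁻¹ := by
  simp [a]

theorem a_succ_self (p : ℕ) : a n p (p + 1) = sigma n p := by
  simp [a_succ, delta_self]

theorem a_mul_delta {p q : ℕ} (h : p ≤ q) : a n p (q + 1) * delta n p q = delta n p (q + 1) := by
  rw [a_succ, delta_succ h, inv_mul_cancel_right]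

theorem commute_delta {p q : ℕ} {x : ArtinBraid n}
    (h : ∀ i, p ≤ i → i < q → Commute (sigma n i) x) : Commute (delta n p q) x := by
  by_cases hpq : p ≤ q
  · induction q, hpq using Nat.le_induction with
    | base =>
      rw [delta_self]
      exact Commute.one_left x
    | succ q hq ih =>
      rw [delta_succ hq]
      exact (ih fun i h1 h2 => h i h1 (by omega)).mul_left (h q hq (by omega))
  · rw [delta, show q - p = 0 by omega]
    exact Commute.one_left x

theorem commute_a {p q : ℕ} (hpq : p < q) {x : ArtinBraid n}
    (h : ∀ i, p ≤ i → i < q → Commute (sigma n i) x) : Commute (a n p q) x := by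
  obtain ⟨q, rfl⟩ : ∃ k, q = k + 1 := ⟨q - 1, by omega⟩
  rw [a_succ]
  have := commute_delta (q := q) fun i h1 h2 => h i h1 (by omega)
  exact (this.mul_left (h q (by omega) (by omega))).mul_left this.inv_left

theorem commute_sigma_a {i p q : ℕ} (hpq : p < q) (h : i + 2 ≤ p ∨ q + 1 ≤ i) :
    Commute (sigma n i) (a n p q) := by
  refine (commute_a hpq fun j h1 h2 => ?_).symm
  rcases h with h | h
  · exact (commute_sigma (by omega)).symm
  · exact commute_sigma (by omega)

theorem a_eq_conj {p q r : ℕ} (h1 : p ≤ q) (h2 : q < r) :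
    a n p r = delta n p q * a n q r * (delta n p q)⁻¹ := by
  obtain ⟨r, rfl⟩ : ∃ k, r = k + 1 := ⟨r - 1, by omega⟩
  rw [a_succ, a_succ, ← delta_mul h1 (by omega : q ≤ r)]
  group

theorem a_mul_a_left {p q r : ℕ} (h1 : p < q) (h2 : q < r) :
    a n p q * a n q r = a n p r * a n p q := by
  obtain ⟨q, rfl⟩ : ∃ k, q = k + 1 := ⟨q - 1, by omega⟩
  have h3 : Commute (delta n p q) (a n (q + 1) r) :=
    commute_delta fun i _ h => commute_sigma_a h2 (Or.inl (by omega))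
  rw [a_eq_conj h1.le h2, ← a_mul_delta (by omega : p ≤ q), mul_inv_rev]
  have h4 := h3.eq
  calc a n p (q + 1) * a n (q + 1) r
      = a n p (q + 1) * (a n (q + 1) r * delta n p q) * (delta n p q)⁻¹ := by group
    _ = _ := by rw [← h4]; group

theorem sigma_mul_a {q r : ℕ} (hq : 1 ≤ q) (hqr : q < r) (hr : r < n) :
    sigma n r * a n q (r + 1) = a n q r * sigma n r := by
  obtain ⟨r, rfl⟩ : ∃ k, r = k + 1 := ⟨r - 1, by omega⟩
  have h1 : Commute (delta n q r) (sigma n (r + 1)) :=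
    commute_delta fun i _ h => commute_sigma (by omega)
  have h2 := sigma_braid n (i := r) (by omega) hr
  rw [a_succ, a_succ, delta_succ (by omega : q ≤ r), mul_inv_rev]
  calc sigma n (r + 1) * (delta n q r * sigma n r * sigma n (r + 1) *
        ((sigma n r)⁻¹ * (delta n q r)⁻¹))
      = (sigma n (r + 1) * delta n q r) * sigma n r * sigma n (r + 1) *
        ((sigma n r)⁻¹ * (delta n q r)⁻¹) := by group
    _ = delta n q r * (sigma n (r + 1) * sigma n r * sigma n (r + 1)) *
        ((sigma n r)⁻¹ * (delta n q r)⁻¹) := by rw [← h1.eq]; group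
    _ = delta n q r * sigma n r * (sigma n (r + 1) * (delta n q r)⁻¹) := by
        rw [← h2]; group
    _ = _ := by rw [← h1.inv_left.eq]; group

theorem a_succ_right {q r : ℕ} (hq : 1 ≤ q) (hqr : q < r) (hr : r < n) :
    a n q (r + 1) = (sigma n r)⁻¹ * a n q r * sigma n r := by
  rw [mul_assoc, ← sigma_mul_a hq hqr hr, inv_mul_cancel_left]

theorem sigma_a_braid {p r : ℕ} (hp : 1 ≤ p) (hpr : p + 2 ≤ r) (hr : r ≤ n) :
    sigma n p * a n (p + 1) r * sigma n p = a n (p + 1) r * sigma n p * a n (p + 1) r := by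
  induction r, hpr using Nat.le_induction with
  | base =>
    rw [a_succ_self]
    exact sigma_braid n hp (by omega)
  | succ r hpr ih =>
    have h1 : Commute (sigma n p) (sigma n r) := commute_sigma (by omega)
    have h2 := ih (by omega)
    rw [a_succ_right (by omega) (by omega) (by omega)]
    calc sigma n p * ((sigma n r)⁻¹ * a n (p + 1) r * sigma n r) * sigma n p
        = (sigma n p * (sigma n r)⁻¹) * a n (p + 1) r * (sigma n r * sigma n p) := by group
      _ = (sigma n r)⁻¹ * (sigma n p * a n (p + 1) r * sigma n p) * sigma n r := by
          rw [h1.inv_right.eq, ← h1.eq]; group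
      _ = (sigma n r)⁻¹ * a n (p + 1) r * (sigma n p * sigma n r) * (sigma n r)⁻¹ *
          a n (p + 1) r * sigma n r := by rw [h2]; group
      _ = _ := by rw [h1.eq]; group

theorem a_mul_a_right {p q r : ℕ} (hp : 1 ≤ p) (h1 : p < q) (h2 : q < r) (hr : r ≤ n) :
    a n q r * a n p r = a n p q * a n q r := by
  obtain ⟨q, rfl⟩ : ∃ k, q = k + 1 := ⟨q - 1, by omega⟩
  have h3 : Commute (delta n p q) (a n (q + 1) r) :=
    commute_delta fun i _ h => commute_sigma_a h2 (Or.inl (by omega))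
  have h4 : a n q r = sigma n q * a n (q + 1) r * (sigma n q)⁻¹ := by
    rw [a_eq_conj (Nat.le_succ q) h2, delta_succ_self]
  have h5 := sigma_a_braid (n := n) (by omega) (by omega : q + 2 ≤ r) hr
  rw [a_succ, a_eq_conj (by omega : p ≤ q) (by omega : q < r), h4]
  calc a n (q + 1) r * (delta n p q * (sigma n q * a n (q + 1) r * (sigma n q)⁻¹) *
        (delta n p q)⁻¹)
      = (a n (q + 1) r * delta n p q) * (sigma n q * a n (q + 1) r * (sigma n q)⁻¹) *
        (delta n p q)⁻¹ := by group
    _ = delta n p q * (a n (q + 1) r * sigma n q * a n (q + 1) r) * (sigma n q)⁻¹ *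
        (delta n p q)⁻¹ := by rw [← h3.eq]; group
    _ = delta n p q * sigma n q * (a n (q + 1) r * (delta n p q)⁻¹) := by
        rw [← h5]; group
    _ = _ := by rw [← h3.inv_left.eq]; group

theorem commute_a_of_lt {p q r s : ℕ} (h1 : p < q) (h2 : q < r) (h3 : r < s) :
    Commute (a n p q) (a n r s) :=
  commute_a h1 fun _ _ _ => commute_sigma_a h3 (Or.inl (by omega))

/-- The braid relations give `x y x⁻¹ = y⁻¹ x y` and `y z y⁻¹ = z⁻¹ y z`, after which only the
commutation of `x` with `z` is needed. This is the base case of nested commutation. -/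
theorem commute_conj_of_braid {G : Type*} [Group G] {x y z : G} (hxy : x * y * x = y * x * y)
    (hyz : y * z * y = z * y * z) (hxz : Commute x z) : Commute (z⁻¹ * (x * y * x⁻¹) * z) y := by
  have h1 : x * y * x⁻¹ = y⁻¹ * x * y := by
    rw [mul_inv_eq_iff_eq_mul]
    have : y * (x * y) = y * (y⁻¹ * x * y * x) := by
      rw [← mul_assoc, ← hxy]; group
    exact mul_left_cancel this
  have h2 : y * z * y⁻¹ = z⁻¹ * y * z := by
    rw [mul_inv_eq_iff_eq_mul]
    have : z * (y * z) = z * (z⁻¹ * y * z * y) := by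
      rw [← mul_assoc, ← hyz]; group
    exact mul_left_cancel this
  rw [h1]
  have h3 : y * (z⁻¹ * (y⁻¹ * x * y) * z) * y⁻¹ = z⁻¹ * (y⁻¹ * x * y) * z := by
    calc y * (z⁻¹ * (y⁻¹ * x * y) * z) * y⁻¹
        = (y * z * y⁻¹)⁻¹ * x * (y * z * y⁻¹) := by group
      _ = z⁻¹ * y⁻¹ * (z * x) * z⁻¹ * y * z := by rw [h2]; group
      _ = _ := by rw [← hxz.eq]; group
  exact (mul_inv_eq_iff_eq_mul.1 h3).symm

/-- Conjugation by `delta n p (r - 1)` and by `σ_i` with `i > s` fixes the inner atom, which reduces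
the outer interval to one point beyond each end of the inner one. -/
theorem commute_a_nested {p q r s : ℕ} (hp : 1 ≤ p) (h1 : p < r) (h2 : r < s) (h3 : s < q)
    (hq : q ≤ n) : Commute (a n p q) (a n r s) := by
  obtain ⟨r, rfl⟩ : ∃ k, r = k + 1 := ⟨r - 1, by omega⟩
  have h4 : ∀ q, s + 1 ≤ q → q ≤ n → Commute (a n r q) (a n (r + 1) s) := by
    intro q hq
    induction q, hq using Nat.le_induction with
    | base =>
      intro hs
      have e1 := sigma_a_braid (n := n) (by omega) (by omega : r + 2 ≤ s) (by omega)
      have e2 : a n r s = sigma n r * a n (r + 1) s * (sigma n r)⁻¹ := by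
        rw [a_eq_conj (Nat.le_succ r) h2, delta_succ_self]
      have e3 : a n (r + 1) s * sigma n s * a n (r + 1) s =
          sigma n s * a n (r + 1) s * sigma n s := by
        obtain ⟨s, rfl⟩ : ∃ k, s = k + 1 := ⟨s - 1, by omega⟩
        have f1 : Commute (delta n (r + 1) s) (sigma n (s + 1)) :=
          commute_delta fun i _ h => commute_sigma (by omega)
        have f2 := sigma_braid n (i := s) (by omega) (by omega)
        have f3 : sigma n (s + 1) =
            delta n (r + 1) s * sigma n (s + 1) * (delta n (r + 1) s)⁻¹ := by
          rw [f1.eq, mul_inv_cancel_right]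
        rw [a_succ, f3]
        calc _ = delta n (r + 1) s * (sigma n s * sigma n (s + 1) * sigma n s) *
              (delta n (r + 1) s)⁻¹ := by group
          _ = _ := by rw [f2]; group
      rw [a_succ_right (by omega) (by omega) (by omega), e2]
      exact commute_conj_of_braid e1 e3 (commute_sigma (by omega))
    | succ q hq ih =>
      intro hn
      have e1 : Commute (sigma n q) (a n (r + 1) s) := commute_sigma_a h2 (Or.inr (by omega))
      rw [a_succ_right (by omega) (by omega) (by omega)]
      exact (e1.inv_left.mul_left (ih (by omega))).mul_left e1
  have h5 : Commute (delta n p r) (a n (r + 1) s) :=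
    commute_delta fun i _ h => commute_sigma_a h2 (Or.inl (by omega))
  rw [a_eq_conj (by omega : p ≤ r) (by omega : r < q)]
  exact (h5.mul_left (h4 q h3 hq)).mul_left h5.inv_left

theorem phi_apply (β : ArtinBraid n) : phi n β = delta n 1 n * β * (delta n 1 n)⁻¹ := rfl

theorem phi_sigma {i : ℕ} (hi : 1 ≤ i) (hin : i + 1 < n) :
    phi n (sigma n i) = sigma n (i + 1) := by
  have h1 : Commute (delta n (i + 2) n) (sigma n i) :=
    commute_delta fun j h _ => (commute_sigma (by omega)).symm
  have h2 : Commute (delta n 1 i) (sigma n (i + 1)) :=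
    commute_delta fun j _ h => commute_sigma (by omega)
  have h3 : delta n 1 n = delta n 1 i * sigma n i * sigma n (i + 1) * delta n (i + 2) n := by
    rw [← delta_mul hi (by omega : i ≤ n), delta_eq_sigma_mul (by omega : i < n),
      delta_eq_sigma_mul hin]
    simp only [mul_assoc]
  rw [phi_apply, mul_inv_eq_iff_eq_mul, h3]
  calc delta n 1 i * sigma n i * sigma n (i + 1) * delta n (i + 2) n * sigma n i
      = delta n 1 i * sigma n i * sigma n (i + 1) * (delta n (i + 2) n * sigma n i) := by group
    _ = delta n 1 i * (sigma n i * sigma n (i + 1) * sigma n i) * delta n (i + 2) n := by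
        rw [h1.eq]; group
    _ = (delta n 1 i * sigma n (i + 1)) * sigma n i * sigma n (i + 1) * delta n (i + 2) n := by
        rw [sigma_braid n hi hin]; group
    _ = _ := by rw [h2.eq]; group

theorem phi_delta {p q : ℕ} (hp : 1 ≤ p) (hpq : p ≤ q) (hq : q < n) :
    phi n (delta n p q) = delta n (p + 1) (q + 1) := by
  induction q, hpq using Nat.le_induction with
  | base => rw [delta_self, delta_self, map_one]
  | succ q hpq ih =>
    rw [delta_succ hpq, map_mul, ih (by omega), phi_sigma (by omega) (by omega),
      ← delta_succ (by omega)]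

theorem phi_a {p q : ℕ} (hp : 1 ≤ p) (hpq : p < q) (hq : q < n) :
    phi n (a n p q) = a n (p + 1) (q + 1) := by
  obtain ⟨q, rfl⟩ : ∃ k, q = k + 1 := ⟨q - 1, by omega⟩
  rw [a_succ, a_succ, map_mul, map_mul, map_inv, phi_delta hp (by omega) (by omega),
    phi_sigma (by omega) hq]

theorem delta_eq_delta_mul_a {p q : ℕ} (hp : 1 ≤ p) (hpq : p < q) (hq : q ≤ n) :
    delta n p q = delta n (p + 1) q * a n p q := by
  induction q, (show p + 1 ≤ q from hpq) using Nat.le_induction with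
  | base => rw [delta_self, delta_succ_self, a_succ_self, one_mul]
  | succ q h ih =>
    rw [delta_succ (by omega), ih (by omega) (by omega), delta_succ h, mul_assoc, mul_assoc,
      sigma_mul_a hp (by omega) (by omega)]

/-- The wrap-around case: `δ_{p,n} a_{p,n} = σ_p δ_{p,n}`, and conjugating `σ_p` by `δ_{1,p}` gives
`a_{1,p+1}`. -/
theorem phi_a_last {p : ℕ} (hp : 1 ≤ p) (hpn : p < n) : phi n (a n p n) = a n 1 (p + 1) := by
  have h1 := delta_eq_delta_mul_a hp hpn le_rfl
  have h2 : delta n p n * a n p n = sigma n p * delta n p n := by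
    rw [delta_eq_sigma_mul hpn, mul_assoc, ← h1, ← delta_eq_sigma_mul hpn]
  rw [phi_apply, mul_inv_eq_iff_eq_mul, ← delta_mul hp hpn.le, mul_assoc, h2, ← mul_assoc,
    ← mul_assoc, a_mul_delta hp, delta_succ hp]

end ArtinBraid

/-! ### Hurwitz relations below the long cycle, and homomorphisms from the braid group -/

section

open Equiv Module AbsOrder

namespace AbsOrder

variable {α : Type*} [Fintype α] [DecidableEq α] {c : Perm α}

/-- The two sides of a Hurwitz relation come from two shortest factorizations of one permutation
below `c`. -/
theorem hurwitzRel_of_mul {G : Type*} [Monoid G] (hc : ∀ p q, Le (swap p q) c)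
    (F : ∀ s, Le s c → G)
    (hF : ∀ (s t : Perm α) (_ : Le s (t * s)) (h2 : Le (t * s) c) (ht : Le t c) (hs : Le s c),
      F t ht * F s hs = F (t * s) h2) :
    HurwitzRel c (fun p q => F (swap p q) (hc p q)) where
  comm p q := by
    have : ∀ (s t : Perm α) (hs : Le s c) (ht : Le t c), s = t → F s hs = F t ht := by
      rintro s _ hs ht rfl
      rfl
    exact this _ _ _ _ (swap_comm p q)
  rel p q r s hpq hrs h1 h2 := by
    have h3 : swap (swap p q r) (swap p q s) * swap p q = swap p q * swap r s := by
      have := swap_apply_apply (swap p q) r s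
      rw [this, swap_inv, mul_assoc, swap_mul_self, mul_one]
    have hne : swap p q r ≠ swap p q s := fun h => hrs ((swap p q).injective h)
    have h4 : Le (swap p q) (swap (swap p q r) (swap p q s) * swap p q) := by
      rw [le_mul_iff, h3, le_mul_iff.1 h1, len_swap hpq, len_swap hrs, len_swap hne]
    have key : ∀ (x y : Perm α) (hx : Le x c) (hy : Le y c), x = y → F x hx = F y hy := by
      rintro x _ hx hy rfl
      rfl
    rw [hF _ _ h1 h2, hF _ _ h4 (h3 ▸ h2)]
    exact key _ _ _ _ h3.symm

/-- The opposite group appears because simple elements act by multiplication on the right. -/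
theorem hurwitzRel_fracAct (hc : ∀ p q, Le (swap p q) c) :
    HurwitzRel c (fun p q => MulOpposite.op (fracAct (swap p q) (hc p q))) :=
  hurwitzRel_of_mul hc (fun s hs => MulOpposite.op (fracAct s hs)) fun _ _ h1 h2 ht hs => by
    rw [← MulOpposite.op_mul, fracAct_mul h1 h2 ht hs]

end AbsOrder

namespace ArtinBraid

variable {n : ℕ}

theorem finRotate_mul_swap_apply {p q r s : Fin (n + 1)} (h : q.1 = p.1 + 1) (hr : p ≠ r)
    (hs : p ≠ s) : (finRotate (n + 1) * swap r s) p = q := by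
  rw [Perm.mul_apply, swap_apply_of_ne_of_ne hr hs, finRotate_apply]
  ext
  rw [Fin.val_add_one_of_lt (by rw [Fin.lt_def, Fin.val_last]; omega), h]

theorem same_finRotate (p q : Fin (n + 1)) : Same (finRotate (n + 1)) p q := by
  intro f hf
  have h : ∀ k (hk : k < n + 1), f ⟨k, hk⟩ = f 0 := by
    intro k
    induction k with
    | zero => intro _; rfl
    | succ k ih =>
      intro hk
      rw [← ih (by omega), ← hf ⟨k, by omega⟩]
      congr 1
      rw [finRotate_apply]
      ext
      rw [Fin.val_add_one_of_lt (by rw [Fin.lt_def, Fin.val_last]; change k < n; omega)]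
  rw [h p.1 p.2, h q.1 q.2]

theorem swap_le_finRotate (p q : Fin (n + 1)) : Le (swap p q) (finRotate (n + 1)) :=
  swap_le_of_same (same_finRotate p q)

/-- Removing `(r s)` from the rotation splits off the interval from `r + 1` to `s` as a separate
cycle, so its indicator is invariant. This turns the order condition into noncrossing. -/
theorem between_of_same {p q r s : Fin (n + 1)} (hrs : r < s)
    (h : Same (finRotate (n + 1) * swap r s) p q) : (r < p ∧ p ≤ s) ↔ (r < q ∧ q ≤ s) := by
  have := h (fun x => if r < x ∧ x ≤ s then 1 else 0) (by
    intro x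
    have h1 : (r < (finRotate (n + 1) * swap r s) x ∧ (finRotate (n + 1) * swap r s) x ≤ s) ↔
        (r < x ∧ x ≤ s) := by
      rw [Perm.mul_apply, finRotate_apply, Fin.lt_def, Fin.le_def, Fin.val_add_one]
      rw [Fin.lt_def] at hrs
      have hs := s.2
      have hx := x.2
      rw [Fin.lt_def, Fin.le_def]
      by_cases hxr : x = r
      · subst hxr
        rw [swap_apply_left]
        split_ifs <;> omega
      · by_cases hxs : x = s
        · subst hxs
          rw [swap_apply_right, if_neg (by rw [Fin.ext_iff, Fin.val_last]; omega)]
          omega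
        · rw [swap_apply_of_ne_of_ne hxr hxs]
          rw [Fin.ext_iff] at hxr hxs
          split_ifs with h2
          · rw [Fin.ext_iff, Fin.val_last] at h2
            omega
          · omega
    simp only [h1])
  by_cases h1 : r < p ∧ p ≤ s <;> by_cases h2 : r < q ∧ q ≤ s <;> simp [h1, h2] at this ⊢

/-- The Birman-Ko-Lee generators, indexed by unordered pairs of points. -/
def atom (n : ℕ) (p q : Fin (n + 1)) : ArtinBraid (n + 1) :=
  a (n + 1) (min p.1 q.1 + 1) (max p.1 q.1 + 1)

theorem atom_comm (p q : Fin (n + 1)) : atom n p q = atom n q p := by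
  rw [atom, atom, min_comm, max_comm]

theorem atom_of_lt {p q : Fin (n + 1)} (h : p < q) : atom n p q = a (n + 1) (p.1 + 1) (q.1 + 1) := by
  rw [Fin.lt_def] at h
  rw [atom, min_eq_left h.le, max_eq_right h.le]

/-- The hypothesis excludes crossing chords and fixes the cyclic order when an endpoint is shared;
what remains are the triangle relations and the commutations of disjoint or nested chords. -/
theorem atom_rel_of_lt {p q r s : Fin (n + 1)} (hpq : p < q) (hrs : r < s)
    (h : (r < p ∧ p ≤ s) ↔ (r < q ∧ q ≤ s)) :
    atom n p q * atom n r s = atom n (swap p q r) (swap p q s) * atom n p q := by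
  have hq := q.2
  have hs := s.2
  by_cases h1 : p = r
  · subst h1
    have h2 : s < q := by
      simp only [lt_irrefl, false_and, false_iff, not_and, not_le] at h
      exact h hpq
    rw [swap_apply_left, swap_apply_of_ne_of_ne hrs.ne' h2.ne, atom_comm q s, atom_of_lt hpq,
      atom_of_lt hrs, atom_of_lt h2]
    rw [Fin.lt_def] at *
    rw [a_mul_a_right (by omega) (by omega) (by omega) (by omega)]
    exact (a_mul_a_left (by omega) (by omega)).symm
  by_cases h2 : q = s
  · subst h2
    have h3 : r < p := (h.2 ⟨hrs, le_rfl⟩).1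
    rw [swap_apply_right, swap_apply_of_ne_of_ne h3.ne hrs.ne, atom_of_lt hpq, atom_of_lt hrs,
      atom_of_lt h3]
    rw [Fin.lt_def] at *
    exact a_mul_a_right (by omega) (by omega) (by omega) (by omega)
  by_cases h3 : q = r
  · subst h3
    rw [swap_apply_right, swap_apply_of_ne_of_ne (hpq.trans hrs).ne' hrs.ne', atom_of_lt hpq,
      atom_of_lt hrs, atom_of_lt (hpq.trans hrs)]
    rw [Fin.lt_def] at *
    exact a_mul_a_left (by omega) (by omega)
  have h4 : p ≠ s := by
    rintro rfl
    exact absurd (h.1 ⟨hrs, le_rfl⟩).2 (not_le.2 hpq)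
  rw [swap_apply_of_ne_of_ne (Ne.symm h1) (Ne.symm h3),
    swap_apply_of_ne_of_ne h4.symm (Ne.symm h2), atom_of_lt hpq, atom_of_lt hrs]
  rw [Fin.lt_def] at *
  rw [Fin.le_def, Fin.le_def] at h
  rw [Fin.lt_def] at h
  rw [Ne, Fin.ext_iff] at h4
  rw [Fin.ext_iff] at h1 h2 h3
  by_cases h5 : q.1 < r.1
  · exact commute_a_of_lt (by omega) (by omega) (by omega)
  by_cases h6 : s.1 < p.1
  · exact (commute_a_of_lt (by omega) (by omega) (by omega)).symm
  by_cases h7 : p.1 < r.1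
  · exact commute_a_nested (by omega) (by omega) (by omega) (by omega) (by omega)
  · exact (commute_a_nested (by omega) (by omega) (by omega) (by omega) (by omega)).symm

theorem hurwitzRel_atom : HurwitzRel (finRotate (n + 1)) (atom n) where
  comm := atom_comm
  rel p q r s hpq hrs h1 h2 := by
    have h3 : Same (finRotate (n + 1) * swap r s) p q := by
      have := h1.le_div h2
      rw [swap_inv] at this
      exact swap_le_iff.1 this
    have key : ∀ {p q r s : Fin (n + 1)}, p ≠ q → r < s →
        Same (finRotate (n + 1) * swap r s) p q →
        atom n p q * atom n r s = atom n (swap p q r) (swap p q s) * atom n p q := by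
      intro p q r s hpq hrs h
      rcases lt_or_gt_of_ne hpq with h4 | h4
      · exact atom_rel_of_lt h4 hrs (between_of_same hrs h)
      · rw [swap_comm, atom_comm p q]
        exact atom_rel_of_lt h4 hrs (between_of_same hrs h).symm
    rcases lt_or_gt_of_ne hrs with h4 | h4
    · exact key hpq h4 h3
    · rw [swap_comm r s] at h3
      rw [atom_comm r s, atom_comm (swap p q r)]
      exact key hpq h4 h3

section Action

variable {G : Type*} [Group G] {A : Fin (n + 1) → Fin (n + 1) → G}

theorem hurwitz_rel_apply (hA : HurwitzRel (finRotate (n + 1)) A) {p q r s : Fin (n + 1)}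
    (hpq : p ≠ q) (hrs : r ≠ s) (h : Same (finRotate (n + 1) * swap r s) p q) :
    A p q * A r s = A (swap p q r) (swap p q s) * A p q := by
  obtain ⟨h1, h2⟩ := swap_mul_swap_le (swap_le_finRotate r s) h
  exact hA.rel p q r s hpq hrs h1 h2

/-- Two Hurwitz moves give `A p q * A q r = A p r * A p q = A q r * A p r`, and the braid relation
follows. -/
theorem hurwitz_braid (hA : HurwitzRel (finRotate (n + 1)) A) {p q r : Fin (n + 1)}
    (hpq : q.1 = p.1 + 1) (hqr : r.1 = q.1 + 1) :
    A p q * A q r * A p q = A q r * A p q * A q r := by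
  have n1 : p ≠ q := by rw [Ne, Fin.ext_iff]; omega
  have n2 : q ≠ r := by rw [Ne, Fin.ext_iff]; omega
  have n3 : p ≠ r := by rw [Ne, Fin.ext_iff]; omega
  have h := same_of_fix (finRotate_mul_swap_apply hpq n1 n3)
  have e1 := hurwitz_rel_apply hA n1 n2 h
  rw [swap_apply_right, swap_apply_of_ne_of_ne n3.symm n2.symm] at e1
  obtain ⟨h1, h2⟩ := swap_mul_swap_le (swap_le_finRotate q r) h
  have h3 : swap p r * swap p q = swap p q * swap q r := by
    have := swap_apply_apply (swap p q) q r
    rw [swap_apply_right, swap_apply_of_ne_of_ne n3.symm n2.symm, swap_inv] at this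
    rw [this, mul_assoc, swap_mul_self, mul_one]
  have e2 := hA.rel p r p q n3 n1 (by
    rw [le_mul_iff, h3, le_mul_iff.1 h1, len_swap n1, len_swap n2, len_swap n3]) (by rwa [h3])
  rw [swap_apply_left, swap_apply_of_ne_of_ne n1.symm n2, hA.comm r q] at e2
  rw [e1, e2, mul_assoc, ← e1, mul_assoc]

theorem hurwitz_comm (hA : HurwitzRel (finRotate (n + 1)) A) {p q r s : Fin (n + 1)}
    (hpq : q.1 = p.1 + 1) (hqr : q.1 < r.1) (hrs : s.1 = r.1 + 1) :
    A p q * A r s = A r s * A p q := by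
  have n1 : p ≠ q := by rw [Ne, Fin.ext_iff]; omega
  have n2 : r ≠ s := by rw [Ne, Fin.ext_iff]; omega
  have n3 : p ≠ r := by rw [Ne, Fin.ext_iff]; omega
  have n4 : p ≠ s := by rw [Ne, Fin.ext_iff]; omega
  have n5 : q ≠ r := by rw [Ne, Fin.ext_iff]; omega
  have n6 : q ≠ s := by rw [Ne, Fin.ext_iff]; omega
  have e1 := hurwitz_rel_apply hA n1 n2 (same_of_fix (finRotate_mul_swap_apply hpq n3 n4))
  rwa [swap_apply_of_ne_of_ne n3.symm n5.symm, swap_apply_of_ne_of_ne n4.symm n6.symm] at e1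

/-- The representation of the braid group given by elements satisfying the Hurwitz relations. -/
def ofHurwitz (hA : HurwitzRel (finRotate (n + 1)) A) : ArtinBraid (n + 1) →* G :=
  PresentedGroup.toGroup
    (f := fun i => A ⟨i.1 - 1, by have := i.2; omega⟩ ⟨i.1, i.2.2⟩) (by
    intro r hr
    cases hr with
    | comm i j h =>
      have := i.2
      simp only [map_mul, map_inv, FreeGroup.lift_apply_of]
      exact mul_inv_eq_one.2 (hurwitz_comm hA (by simp only; omega) (by simp only; omega)
        (by simp only; omega))
    | braid i j h =>
      have h1 := i.2
      simp only [map_mul, map_inv, FreeGroup.lift_apply_of]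
      have h2 : (⟨j.1 - 1, by have := j.2; omega⟩ : Fin (n + 1)) = ⟨i.1, i.2.2⟩ := by
        ext
        simp only
        omega
      rw [h2]
      exact mul_inv_eq_one.2 (hurwitz_braid hA (by simp only; omega) (by simp only; omega)))

theorem ofHurwitz_sigma (hA : HurwitzRel (finRotate (n + 1)) A) {i : ℕ} (h1 : i + 1 < n + 1) :
    ofHurwitz hA (sigma (n + 1) (i + 1)) = A ⟨i, by omega⟩ ⟨i + 1, h1⟩ := by
  have h2 : 1 ≤ i + 1 ∧ i + 1 < n + 1 := ⟨by omega, h1⟩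
  rw [sigma, dif_pos h2, ofHurwitz, PresentedGroup.toGroup.of]
  rfl

/-- By induction on the distance of the points: both families satisfy the same recursion,
conjugation by the atom of the first two neighbouring points. -/
theorem ofHurwitz_atom (hA : HurwitzRel (finRotate (n + 1)) A) {p q : Fin (n + 1)} (h : p ≠ q) :
    ofHurwitz hA (atom n p q) = A p q := by
  have key : ∀ k p q (h1 : q = p + k + 1) (hq : q < n + 1),
      ofHurwitz hA (a (n + 1) (p + 1) (q + 1)) = A ⟨p, by omega⟩ ⟨q, hq⟩ := by
    intro k
    induction k with
    | zero =>
      rintro p q rfl hq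
      rw [add_zero] at hq
      exact (congrArg _ (a_succ_self _)).trans (ofHurwitz_sigma hA hq)
    | succ k ih =>
      intro p q h1 hq
      have e := ih (p + 1) q (by omega) hq
      have n1 : (⟨p, by omega⟩ : Fin (n + 1)) ≠ ⟨p + 1, by omega⟩ := by
        rw [Ne, Fin.ext_iff]; simp
      have n2 : (⟨p + 1, by omega⟩ : Fin (n + 1)) ≠ ⟨q, hq⟩ := by
        rw [Ne, Fin.ext_iff]; simp only; omega
      have n3 : (⟨p, by omega⟩ : Fin (n + 1)) ≠ ⟨q, hq⟩ := by
        rw [Ne, Fin.ext_iff]; simp only; omega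
      have e1 := hurwitz_rel_apply hA n1 n2
        (same_of_fix (finRotate_mul_swap_apply (by simp only) n1 n3))
      rw [swap_apply_right, swap_apply_of_ne_of_ne n3.symm n2.symm] at e1
      rw [a_eq_conj (Nat.le_succ (p + 1)) (by omega), delta_succ_self, map_mul, map_mul, map_inv,
        ofHurwitz_sigma hA (by omega), e, e1, mul_inv_cancel_right]
  rcases lt_or_gt_of_ne h with h1 | h1
  · rw [atom_of_lt h1]
    rw [Fin.lt_def] at h1
    exact key (q.1 - p.1 - 1) p.1 q.1 (by omega) q.2
  · rw [atom_comm, atom_of_lt h1, hA.comm]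
    rw [Fin.lt_def] at h1
    exact key (p.1 - q.1 - 1) q.1 p.1 (by omega) p.2

end Action

end ArtinBraid

end

/-! ### Normal forms and common multiples in the dual braid monoid -/

section

open Equiv Module AbsOrder

namespace ArtinBraid

variable {n : ℕ}

/-- The exponent sum of a braid. -/
def expSum (n : ℕ) : ArtinBraid n →* Multiplicative ℤ :=
  PresentedGroup.toGroup (f := fun _ => Multiplicative.ofAdd 1) (by
    intro r hr
    cases hr <;>
    · simp only [map_mul, map_inv, FreeGroup.lift_apply_of]
      exact mul_inv_cancel _)

theorem expSum_sigma {i : ℕ} (h : 1 ≤ i ∧ i < n) : expSum n (sigma n i) = Multiplicative.ofAdd 1 := by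
  rw [sigma, dif_pos h, expSum, PresentedGroup.toGroup.of]

theorem expSum_a {p q : ℕ} (hp : 1 ≤ p) (hpq : p < q) (hq : q ≤ n) :
    expSum n (a n p q) = Multiplicative.ofAdd 1 := by
  rw [a, map_mul, map_mul, map_inv, mul_comm, inv_mul_cancel_left,
    expSum_sigma ⟨by omega, by omega⟩]

/-- The length of a positive braid. -/
def length (n : ℕ) (β : ArtinBraid n) : ℕ := (expSum n β).toAdd.toNat

theorem atom_mem {p q : Fin (n + 1)} (h : p ≠ q) : atom n p q ∈ BKL (n + 1) := by
  have key : ∀ {p q : Fin (n + 1)}, p < q → atom n p q ∈ BKL (n + 1) := by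
    intro p q h
    rw [atom_of_lt h]
    have := q.2
    rw [Fin.lt_def] at h
    exact Submonoid.subset_closure ⟨_, _, by omega, by omega, by omega, rfl⟩
  rcases lt_or_gt_of_ne h with h | h
  · exact key h
  · rw [atom_comm]
    exact key h

theorem exists_atom {p q : ℕ} (hp : 1 ≤ p) (hpq : p < q) (hq : q ≤ n + 1) :
    ∃ p' q' : Fin (n + 1), p' ≠ q' ∧ p'.1 + 1 = p ∧ q'.1 + 1 = q ∧
      a (n + 1) p q = atom n p' q' := by
  refine ⟨⟨p - 1, by omega⟩, ⟨q - 1, by omega⟩, ?_, ?_, ?_, ?_⟩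
  · rw [Ne, Fin.ext_iff]
    simp only
    omega
  · simp only
    omega
  · simp only
    omega
  · rw [atom_of_lt (by rw [Fin.lt_def]; simp only; omega)]
    congr 1 <;> simp only <;> omega

theorem expSum_of_mem {β : ArtinBraid n} (h : β ∈ BKL n) :
    expSum n β = Multiplicative.ofAdd (length n β : ℤ) := by
  have : ∃ k : ℕ, expSum n β = Multiplicative.ofAdd (k : ℤ) := by
    induction h using Submonoid.closure_induction with
    | mem x hx =>
      obtain ⟨p, q, h1, h2, h3, rfl⟩ := hx
      exact ⟨1, expSum_a h1 h2 h3⟩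
    | one => exact ⟨0, map_one _⟩
    | mul x y _ _ hx hy =>
      obtain ⟨k, hk⟩ := hx
      obtain ⟨l, hl⟩ := hy
      exact ⟨k + l, by rw [map_mul, hk, hl, ← ofAdd_add, Nat.cast_add]⟩
  obtain ⟨k, hk⟩ := this
  simp [length, hk]

theorem length_mul {β γ : ArtinBraid n} (hβ : β ∈ BKL n) (hγ : γ ∈ BKL n) :
    length n (β * γ) = length n β + length n γ := by
  have h := expSum_of_mem (mul_mem hβ hγ)
  rw [map_mul, expSum_of_mem hβ, expSum_of_mem hγ, ← ofAdd_add] at h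
  have := Multiplicative.ofAdd.injective h
  omega

theorem length_one : length n 1 = 0 := by simp [length]

theorem length_a {p q : ℕ} (hp : 1 ≤ p) (hpq : p < q) (hq : q ≤ n) :
    length n (a n p q) = 1 := by
  simp [length, expSum_a hp hpq hq]

theorem length_atom {p q : Fin (n + 1)} (h : p ≠ q) : length (n + 1) (atom n p q) = 1 := by
  have := p.2
  have := q.2
  rw [Ne, Fin.ext_iff] at h
  exact length_a (by omega) (by omega) (by omega)

theorem eq_one_or_mul_a {β : ArtinBraid n} (h : β ∈ BKL n) : β = 1 ∨
    ∃ γ ∈ BKL n, ∃ p q, 1 ≤ p ∧ p < q ∧ q ≤ n ∧ β = γ * a n p q := by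
  induction h using Submonoid.closure_induction_right with
  | one => exact Or.inl rfl
  | mul_right x hx y hy _ =>
    obtain ⟨p, q, h1, h2, h3, rfl⟩ := hy
    exact Or.inr ⟨x, hx, p, q, h1, h2, h3, rfl⟩

theorem eq_one_of_length {β : ArtinBraid n} (h : β ∈ BKL n) (h0 : length n β = 0) : β = 1 := by
  rcases eq_one_or_mul_a h with h1 | ⟨γ, hγ, p, q, h1, h2, h3, rfl⟩
  · exact h1
  · rw [length_mul hγ (Submonoid.subset_closure ⟨p, q, h1, h2, h3, rfl⟩),
      length_a h1 h2 h3] at h0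
    omega

/-- The right action of the braid group on fractions of normal sequences. -/
noncomputable def normalAction (n : ℕ) :
    ArtinBraid (n + 1) →* (Perm (FracSeq (finRotate (n + 1))))ᵐᵒᵖ :=
  ofHurwitz (hurwitzRel_fracAct swap_le_finRotate)

/-- Since the sequence is obtained from the group action, it depends on the braid only and not on a
word for it; `partialProd_mul_lift` shows that its product is the braid. -/
theorem exists_normalSeq {β : ArtinBraid (n + 1)} (h : β ∈ BKL (n + 1)) :
    ∃ U : NormalSeq (finRotate (n + 1)),
      (normalAction n β).unop (Loc.of _ (NormalSeq.one _)) = Loc.of _ U ∧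
      ∃ m, (∀ k, m ≤ k → U.seq k = 1) ∧ β = partialProd (atom n) U.seq m := by
  induction h using Submonoid.closure_induction_right with
  | one => exact ⟨NormalSeq.one _, by simp, 0, fun _ _ => rfl, rfl⟩
  | mul_right x hx y hy ih =>
    obtain ⟨U, h1, m, h2, h3⟩ := ih
    obtain ⟨p, q, hp, hpq, hq, rfl⟩ := hy
    obtain ⟨p, q, h, -, -, e⟩ := exists_atom hp hpq hq
    rw [e]
    have hs := swap_le_finRotate p q
    -- Multiplying by one atom lengthens the normal form by at most one term.
    refine ⟨act U _ hs, ?_, m + 1, ?_, ?_⟩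
    · rw [map_mul, MulOpposite.unop_mul, Perm.mul_apply, h1, normalAction, ofHurwitz_atom _ h,
        MulOpposite.unop_op, fracAct_of]
    · intro k hk
      obtain ⟨k, rfl⟩ : ∃ j, k = j + 1 := ⟨k - 1, by omega⟩
      have h4 := absorbed_le (U.le (k + 1)) (carry_le U.le hs (k + 1))
      simp only [act]
      rw [h2 (k + 1) (by omega)] at h4 ⊢
      rw [eq_one_of_le_one h4, carry_eq_one (h2 k (by omega)) _ hs, mul_one]
    · have h4 := partialProd_mul_lift hurwitzRel_atom U hs (m + 1)
      rw [carry_eq_one (h2 m le_rfl) _ hs, lift_one hurwitzRel_atom, one_mul,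
        lift_swap hurwitzRel_atom h hs, partialProd, h2 m le_rfl, lift_one hurwitzRel_atom,
        one_mul, ← h3] at h4
      exact h4

theorem lift_atom_mem (w : Perm (Fin (n + 1))) (hw : Le w (finRotate (n + 1))) :
    lift (atom n) w ∈ BKL (n + 1) :=
  (isLift_lift w).mem hw fun _ _ h _ => atom_mem h

/-- Every element of the dual braid monoid has a simple right divisor that contains all the atoms
which divide it on the right. -/
theorem exists_simple_tail {β : ArtinBraid (n + 1)} (h : β ∈ BKL (n + 1)) :
    ∃ w, Le w (finRotate (n + 1)) ∧ (∃ γ ∈ BKL (n + 1), β = γ * lift (atom n) w) ∧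
      ∀ p q, p ≠ q → BKL.RightDvd (n + 1) (atom n p q) β → Le (swap p q) w := by
  obtain ⟨U, h1, m, h2, h3⟩ := exists_normalSeq h
  refine ⟨U.seq 0, U.le 0, ?_, ?_⟩
  · have h4 : β = partialProd (atom n) U.seq (m + 1) := by
      rw [partialProd, h2 m le_rfl, lift_one hurwitzRel_atom, one_mul, h3]
    rw [h4]
    clear h1 h2 h3 h4
    induction m with
    | zero => exact ⟨1, one_mem _, by simp [partialProd]⟩
    | succ m ih =>
      obtain ⟨γ, hγ, e⟩ := ih
      rw [partialProd, e]
      exact ⟨_, mul_mem (lift_atom_mem _ (U.le _)) hγ, (mul_assoc _ _ _).symm⟩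
  -- The normal form of `γ` times the atom is also the action of the atom on the normal form of `γ`,
  -- whose rightmost term contains the atom by construction.
  · rintro p q hpq ⟨γ, hγ, rfl⟩
    obtain ⟨V, g1, -⟩ := exists_normalSeq hγ
    have hs := swap_le_finRotate p q
    rw [map_mul, MulOpposite.unop_mul, Perm.mul_apply, g1, normalAction, ofHurwitz_atom _ hpq,
      MulOpposite.unop_op, fracAct_of] at h1
    rw [← Loc.of_injective _ h1]
    exact (le_absorbed_mul (V.le 0) hs).1

/-- The long cycle on all the points but the last one. -/
def innerCycle (n : ℕ) : Perm (Fin (n + 2)) :=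
  finRotate (n + 2) * (swap ⟨n, by omega⟩ (Fin.last (n + 1)))⁻¹

theorem innerCycle_le : Le (innerCycle n) (finRotate (n + 2)) := (swap_le_finRotate _ _).div_le

theorem swap_le_innerCycle {p q : Fin (n + 2)} (h : p ≠ q) :
    Le (swap p q) (innerCycle n) ↔ p ≠ Fin.last (n + 1) ∧ q ≠ Fin.last (n + 1) := by
  rw [swap_le_iff]
  constructor
  · intro h1
    have hl : innerCycle n (Fin.last (n + 1)) = Fin.last (n + 1) := by
      rw [innerCycle, swap_inv, Perm.mul_apply, swap_apply_right, finRotate_apply]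
      ext
      rw [Fin.val_add_one_of_lt (by rw [Fin.lt_def, Fin.val_last]; simp only; omega), Fin.val_last]
    have h2 := h1 (fun x => if x = Fin.last (n + 1) then 1 else 0) (by
      intro x
      have : innerCycle n x = Fin.last (n + 1) ↔ x = Fin.last (n + 1) := by
        conv_lhs => rw [← hl]
        exact (innerCycle n).injective.eq_iff
      simp only [this])
    split_ifs at h2 with h3 h4 h4
    · exact absurd (h3.trans h4.symm) h
    · norm_num at h2
    · norm_num at h2
    · exact ⟨h3, h4⟩
  · rintro ⟨hp, hq⟩ f hf
    have key : ∀ k (hk : k < n + 1), f ⟨k, by omega⟩ = f 0 := by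
      intro k
      induction k with
      | zero => intro _; rfl
      | succ k ih =>
        intro hk
        rw [← ih (by omega), ← hf ⟨k, by omega⟩]
        congr 1
        rw [innerCycle, swap_inv, finRotate_mul_swap_apply (q := ⟨k + 1, by omega⟩)]
        · rfl
        · rw [Ne, Fin.ext_iff]
          simp only
          omega
        · rw [Ne, Fin.ext_iff, Fin.val_last]
          simp only
          omega
    have hp' := Fin.val_lt_last hp
    have hq' := Fin.val_lt_last hq
    rw [show f p = f 0 from key p.1 hp', show f q = f 0 from key q.1 hq']

theorem mem_map_incl_atom {p q : Fin (n + 2)} (h : p ≠ q) (hp : p ≠ Fin.last (n + 1))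
    (hq : q ≠ Fin.last (n + 1)) : atom (n + 1) p q ∈ (BKL (n + 1)).map (incl (n + 1)) := by
  have hp' := Fin.val_lt_last hp
  have hq' := Fin.val_lt_last hq
  rw [Ne, Fin.ext_iff] at h
  exact ⟨a (n + 1) (min p.1 q.1 + 1) (max p.1 q.1 + 1),
    Submonoid.subset_closure ⟨_, _, by omega, by omega, by omega, rfl⟩,
    incl_a _ (by omega) (by omega) (by omega)⟩

theorem eq_one_or_mul_atom {x : ArtinBraid (n + 2)} (h : x ∈ (BKL (n + 1)).map (incl (n + 1))) :
    x = 1 ∨ ∃ y ∈ (BKL (n + 1)).map (incl (n + 1)), ∃ p q, p ≠ q ∧ p ≠ Fin.last (n + 1) ∧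
      q ≠ Fin.last (n + 1) ∧ x = y * atom (n + 1) p q := by
  obtain ⟨x, hx, rfl⟩ := h
  rcases eq_one_or_mul_a hx with h1 | ⟨γ, hγ, p, q, h1, h2, h3, rfl⟩
  · exact Or.inl (by rw [h1, map_one])
  · obtain ⟨p', q', h4, h5, h6, h7⟩ := exists_atom (n := n + 1) h1 h2 (by omega)
    refine Or.inr ⟨_, ⟨γ, hγ, rfl⟩, p', q', h4, ?_, ?_, ?_⟩
    · rw [Ne, Fin.ext_iff, Fin.val_last]
      omega
    · rw [Ne, Fin.ext_iff, Fin.val_last]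
      omega
    · rw [map_mul, incl_a _ h1 h2 h3, h7]

theorem map_incl_le : (BKL (n + 1)).map (incl (n + 1)) ≤ BKL (n + 2) := by
  rintro _ ⟨x, hx, rfl⟩
  exact BKL.incl_mem _ ⟨x, hx⟩

/-- Two right divisors from the smaller monoid have a common left multiple in the smaller monoid
which is again a right divisor. -/
theorem exists_common_multiple {β : ArtinBraid (n + 2)} (hβ : β ∈ BKL (n + 2))
    {x y : ArtinBraid (n + 2)} (hx : x ∈ (BKL (n + 1)).map (incl (n + 1)))
    (hy : y ∈ (BKL (n + 1)).map (incl (n + 1))) (hxβ : BKL.RightDvd (n + 2) x β)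
    (hyβ : BKL.RightDvd (n + 2) y β) :
    ∃ z ∈ (BKL (n + 1)).map (incl (n + 1)),
      (∃ u ∈ (BKL (n + 1)).map (incl (n + 1)), z = u * x) ∧
      (∃ v ∈ (BKL (n + 1)).map (incl (n + 1)), z = v * y) ∧ BKL.RightDvd (n + 2) z β := by
  induction hk : length (n + 2) β using Nat.strong_induction_on generalizing β x y with
  | _ k ih =>
    rcases eq_one_or_mul_atom hx with rfl | ⟨x', hx', p, q, hpq, hp, hq, rfl⟩
    · exact ⟨y, hy, ⟨y, hy, (mul_one y).symm⟩, ⟨1, one_mem _, (one_mul y).symm⟩, hyβ⟩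
    rcases eq_one_or_mul_atom hy with rfl | ⟨y', hy', r, s, hrs, hr, hs, rfl⟩
    · exact ⟨_, hx, ⟨1, one_mem _, (one_mul _).symm⟩, ⟨_, hx, (mul_one _).symm⟩, hxβ⟩
    -- Two divisors ending in the same atom: cancel it, and use induction on the length of `β`.
    have div : ∀ {p q : Fin (n + 2)} {x y : ArtinBraid (n + 2)}, p ≠ q →
        x ∈ (BKL (n + 1)).map (incl (n + 1)) → y ∈ (BKL (n + 1)).map (incl (n + 1)) →
        p ≠ Fin.last (n + 1) → q ≠ Fin.last (n + 1) →
        BKL.RightDvd (n + 2) (x * atom (n + 1) p q) β →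
        BKL.RightDvd (n + 2) (y * atom (n + 1) p q) β →
        ∃ z ∈ (BKL (n + 1)).map (incl (n + 1)),
        (∃ u ∈ (BKL (n + 1)).map (incl (n + 1)), z = u * (x * atom (n + 1) p q)) ∧
        (∃ v ∈ (BKL (n + 1)).map (incl (n + 1)), z = v * (y * atom (n + 1) p q)) ∧
        BKL.RightDvd (n + 2) z β := by
      rintro p q x y hpq hx hy hp hq ⟨γ, hγ, e1⟩ ⟨γ', hγ', e2⟩
      have e3 : γ * x = γ' * y := by
        apply mul_right_cancel (b := atom (n + 1) p q)
        rw [mul_assoc, ← e1, mul_assoc, e2]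
      have m1 : γ * x ∈ BKL (n + 2) := mul_mem hγ (map_incl_le hx)
      have l1 : length (n + 2) β = length (n + 2) (γ * x) + 1 := by
        rw [e1, ← mul_assoc, length_mul m1 (atom_mem hpq), length_atom hpq]
      obtain ⟨z, hz, ⟨u, hu, f1⟩, ⟨v, hv, f2⟩, ⟨g, hg, f3⟩⟩ := ih _ (by omega) m1 hx hy ⟨γ, hγ, rfl⟩
        ⟨γ', hγ', e3⟩ rfl
      refine ⟨z * atom (n + 1) p q, mul_mem hz (mem_map_incl_atom hpq hp hq), ⟨u, hu, ?_⟩,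
        ⟨v, hv, ?_⟩, ⟨g, hg, ?_⟩⟩
      · rw [f1, mul_assoc]
      · rw [f2, mul_assoc]
      · rw [e1, ← mul_assoc, f3, mul_assoc]
    -- The last atoms of `x` and of `y` both lie below `w` and below `innerCycle n`, hence below
    -- their meet `v`. The lift of `v` belongs to the smaller monoid, right-divides `β` and can be
    -- written so as to end in either atom.
    obtain ⟨w, hw, ⟨γ, hγ, e1⟩, h1⟩ := exists_simple_tail hβ
    have dvd_of_mul : ∀ {x y : ArtinBraid (n + 2)}, x ∈ (BKL (n + 1)).map (incl (n + 1)) →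
        BKL.RightDvd (n + 2) (x * y) β → BKL.RightDvd (n + 2) y β := by
      rintro x y hx ⟨γ, hγ, e⟩
      exact ⟨γ * x, mul_mem hγ (map_incl_le hx), by rw [e, mul_assoc]⟩
    have w1 := h1 p q hpq (dvd_of_mul hx' hxβ)
    have w2 := h1 r s hrs (dvd_of_mul hy' hyβ)
    obtain ⟨i1, i2, i3⟩ := inf_spec hw (innerCycle_le (n := n))
    set v := inf (finRotate (n + 2)) w (innerCycle n) with hv
    have v1 := i3 _ w1 ((swap_le_innerCycle hpq).2 ⟨hp, hq⟩)
    have v2 := i3 _ w2 ((swap_le_innerCycle hrs).2 ⟨hr, hs⟩)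
    have lK : ∀ {w : Perm (Fin (n + 2))}, Le w (innerCycle n) →
        lift (atom (n + 1)) w ∈ (BKL (n + 1)).map (incl (n + 1)) := by
      intro w hw
      exact (isLift_lift w).mem hw fun p q h h1 =>
        mem_map_incl_atom h ((swap_le_innerCycle h).1 h1).1 ((swap_le_innerCycle h).1 h1).2
    have split : ∀ {y v : Perm (Fin (n + 2))}, Le y v → Le v (finRotate (n + 2)) →
        lift (atom (n + 1)) v = lift (atom (n + 1)) (v * y⁻¹) * lift (atom (n + 1)) y := by
      intro y v h1 h2
      rw [← lift_mul hurwitzRel_atom, inv_mul_cancel_right]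
      · rwa [inv_mul_cancel_right]
      · rwa [inv_mul_cancel_right]
    have vc := i1.trans hw
    have d1 := split v1 vc
    have d2 := split v2 vc
    rw [lift_swap hurwitzRel_atom hpq (swap_le_finRotate _ _)] at d1
    rw [lift_swap hurwitzRel_atom hrs (swap_le_finRotate _ _)] at d2
    have d3 : BKL.RightDvd (n + 2) (lift (atom (n + 1)) v) β := by
      refine ⟨γ * lift (atom (n + 1)) (w * v⁻¹), mul_mem hγ (lift_atom_mem _ (i1.div_le.trans hw)), ?_⟩
      rw [mul_assoc, ← split i1 hw, e1]
    have d4 := d3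
    rw [d1] at d3
    -- First combine `x` with the lift of `v` along the atom of `x`. The result is a multiple of the
    -- lift, so it also ends in the atom of `y` and can be combined with `y`.
    obtain ⟨z, hz, ⟨u, hu, f1⟩, ⟨t, ht, f2⟩, f3⟩ := div hpq hx' (lK (v1.div_le.trans i2)) hp hq hxβ d3
    rw [← d1, d2, ← mul_assoc] at f2
    have f4 := f3
    rw [f2] at f4
    obtain ⟨z', hz', ⟨u', hu', g1⟩, ⟨t', ht', g2⟩, g3⟩ := div hrs hy'
      (mul_mem ht (lK (v2.div_le.trans i2))) hr hs hyβ f4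
    refine ⟨z', hz', ⟨t' * u, mul_mem ht' hu, ?_⟩, ⟨u', hu', g1⟩, g3⟩
    rw [g2, ← f2, f1, mul_assoc]

end ArtinBraid

end

/-! ### Forgetting a strand: injectivity of the canonical homomorphism -/

section

open Equiv

namespace ArtinBraid

variable {n : ℕ}

/-- The effect of `σ_i` on a pair made of a marked position and of the braid obtained by forgetting
the strand that starts at that position. -/
def forgetStep (n i : ℕ) (x : ℕ × ArtinBraid n) : ℕ × ArtinBraid n :=
  if x.1 = i then (i + 1, x.2) else if x.1 = i + 1 then (i, x.2)
  -- Positions that carry no strand are left alone, so that the braid relations hold for every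
  -- natural number.
  else if x.1 = 0 ∨ n + 1 < x.1 then x
  else if x.1 < i then (x.1, sigma n (i - 1) * x.2) else (x.1, sigma n i * x.2)

theorem forgetStep_self (i : ℕ) (β : ArtinBraid n) : forgetStep n i (i, β) = (i + 1, β) := by
  simp [forgetStep]

theorem forgetStep_succ (i : ℕ) (β : ArtinBraid n) : forgetStep n i (i + 1, β) = (i, β) := by
  simp [forgetStep]

theorem forgetStep_out {i k : ℕ} (hi : 1 ≤ i ∧ i < n + 1) (hk : k = 0 ∨ n + 1 < k)
    (β : ArtinBraid n) : forgetStep n i (k, β) = (k, β) := by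
  rw [forgetStep, if_neg (by simp only; omega), if_neg (by simp only; omega), if_pos hk]

theorem forgetStep_lo {i k : ℕ} (hk : 1 ≤ k) (hi : i < n + 1) (h : k < i) (β : ArtinBraid n) :
    forgetStep n i (k, β) = (k, sigma n (i - 1) * β) := by
  rw [forgetStep, if_neg (by simp only; omega), if_neg (by simp only; omega),
    if_neg (by simp only; omega), if_pos h]

theorem forgetStep_hi {i k : ℕ} (h : i + 1 < k) (hk : k ≤ n + 1) (β : ArtinBraid n) :
    forgetStep n i (k, β) = (k, sigma n i * β) := by
  rw [forgetStep, if_neg (by simp only; omega), if_neg (by simp only; omega),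
    if_neg (by simp only; omega), if_neg (by simp only; omega)]

theorem forgetStep_bijective (i : ℕ) : Function.Bijective (forgetStep n i) := by
  have key : ∀ k : ℕ, k ≠ i → k ≠ i + 1 → ∃ g : ArtinBraid n, ∀ β, forgetStep n i (k, β) = (k, g * β) := by
    intro k h1 h2
    simp only [forgetStep, if_neg h1, if_neg h2]
    by_cases h3 : k = 0 ∨ n + 1 < k
    · exact ⟨1, fun β => by rw [if_pos h3, one_mul]⟩
    · by_cases h4 : k < i
      · exact ⟨_, fun β => by rw [if_neg h3, if_pos h4]⟩
      · exact ⟨_, fun β => by rw [if_neg h3, if_neg h4]⟩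
  have fst : ∀ x, (forgetStep n i x).1 = swap i (i + 1) x.1 := by
    rintro ⟨k, β⟩
    by_cases h1 : k = i
    · subst h1
      rw [forgetStep_self, swap_apply_left]
    · by_cases h2 : k = i + 1
      · subst h2
        rw [forgetStep_succ, swap_apply_right]
      · obtain ⟨g, hg⟩ := key k h1 h2
        rw [hg, swap_apply_of_ne_of_ne h1 h2]
  constructor
  · rintro ⟨k, β⟩ ⟨l, γ⟩ h
    have h0 := congrArg Prod.fst h
    rw [fst, fst] at h0
    have h1 : k = l := (swap i (i + 1)).injective h0
    subst h1
    by_cases h1 : k = i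
    · subst h1
      rw [forgetStep_self, forgetStep_self, Prod.mk.injEq] at h
      rw [h.2]
    · by_cases h2 : k = i + 1
      · subst h2
        rw [forgetStep_succ, forgetStep_succ, Prod.mk.injEq] at h
        rw [h.2]
      · obtain ⟨g, hg⟩ := key k h1 h2
        rw [hg, hg, Prod.mk.injEq] at h
        rw [mul_left_cancel h.2]
  · rintro ⟨k, β⟩
    by_cases h1 : k = i
    · exact ⟨(i + 1, β), by rw [forgetStep_succ, h1]⟩
    · by_cases h2 : k = i + 1
      · exact ⟨(i, β), by rw [forgetStep_self, h2]⟩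
      · obtain ⟨g, hg⟩ := key k h1 h2
        exact ⟨(k, g⁻¹ * β), by rw [hg, mul_inv_cancel_left]⟩

theorem forgetStep_comm {i j : ℕ} (hi : 1 ≤ i) (hij : i + 2 ≤ j) (hj : j < n + 1)
    (x : ℕ × ArtinBraid n) :
    forgetStep n i (forgetStep n j x) = forgetStep n j (forgetStep n i x) := by
  obtain ⟨k, β⟩ := x
  rcases (by omega : (k = 0 ∨ n + 1 < k) ∨ (1 ≤ k ∧ k < i) ∨ k = i ∨ k = i + 1 ∨
    (i + 1 < k ∧ k < j) ∨ k = j ∨ k = j + 1 ∨ (j + 1 < k ∧ k ≤ n + 1)) with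
    h | h | rfl | rfl | h | rfl | rfl | h <;>
  simp (disch := omega) only [forgetStep_out, forgetStep_lo, forgetStep_hi, forgetStep_self,
    forgetStep_succ, ← mul_assoc]
  · rw [(commute_sigma (by omega : i - 1 + 2 ≤ j - 1)).eq]
  · rw [(commute_sigma (by omega : i + 2 ≤ j - 1)).eq]
  · rw [(commute_sigma hij).eq]

theorem forgetStep_braid {i : ℕ} (hi : 1 ≤ i) (hin : i + 1 < n + 1) (x : ℕ × ArtinBraid n) :
    forgetStep n i (forgetStep n (i + 1) (forgetStep n i x)) =
      forgetStep n (i + 1) (forgetStep n i (forgetStep n (i + 1) x)) := by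
  obtain ⟨k, β⟩ := x
  rcases (by omega : (k = 0 ∨ n + 1 < k) ∨ (1 ≤ k ∧ k < i) ∨ k = i ∨ k = i + 1 ∨ k = i + 1 + 1 ∨
    (i + 1 + 1 < k ∧ k ≤ n + 1)) with h | h | rfl | rfl | rfl | h <;>
  simp (disch := omega) only [forgetStep_out, forgetStep_lo, forgetStep_hi, forgetStep_self,
    forgetStep_succ, Nat.add_sub_cancel, ← mul_assoc]
  · obtain ⟨i, rfl⟩ : ∃ j, i = j + 1 := ⟨i - 1, by omega⟩
    rw [Nat.add_sub_cancel, sigma_braid n (by omega) (by omega)]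
  · rw [sigma_braid n hi (by omega)]

/-- The action of the braid group on marked positions and braids with a forgotten strand. -/
noncomputable def forget (n : ℕ) : ArtinBraid (n + 1) →* Perm (ℕ × ArtinBraid n) :=
  PresentedGroup.toGroup (f := fun i => Equiv.ofBijective _ (forgetStep_bijective (n := n) i.1)) (by
    intro r hr
    cases hr with
    | comm i j h =>
      simp only [map_mul, map_inv, FreeGroup.lift_apply_of]
      exact mul_inv_eq_one.2 (Equiv.ext (forgetStep_comm i.2.1 h j.2.2))
    | braid i j h =>
      have h1 := j.2.2
      simp only [map_mul, map_inv, FreeGroup.lift_apply_of, h]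
      exact mul_inv_eq_one.2 (Equiv.ext (forgetStep_braid i.2.1 (by omega))))

theorem forget_sigma {i : ℕ} (h : 1 ≤ i ∧ i < n + 1) (x : ℕ × ArtinBraid n) :
    forget n (sigma (n + 1) i) x = forgetStep n i x := by
  rw [sigma, dif_pos h, forget, PresentedGroup.toGroup.of]
  rfl

/-- The generators coming from `B_n` never touch the last strand, so forgetting that strand recovers
the braid. -/
theorem forget_incl (β γ : ArtinBraid n) : forget n (incl n β) (n + 1, γ) = (n + 1, β * γ) := by
  have h : β ∈ Subgroup.closure (Set.range (PresentedGroup.of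
      (rels := {r : FreeGroup {i : ℕ // 1 ≤ i ∧ i < n} | ArtinRel n r}))) := by
    rw [PresentedGroup.closure_range_of]
    exact Subgroup.mem_top β
  induction h using Subgroup.closure_induction generalizing γ with
  | mem x hx =>
    obtain ⟨i, rfl⟩ := hx
    have h1 : PresentedGroup.of i = sigma n i.1 := by rw [sigma, dif_pos i.2]
    have := i.2
    rw [h1, incl_sigma n i.2, forget_sigma (by omega), forgetStep_hi (by omega) (by omega)]
  | one => simp
  | mul x y _ _ hx hy => rw [map_mul, map_mul, Perm.mul_apply, hy, hx, mul_assoc]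
  | inv x _ hx => rw [map_inv, map_inv, Perm.inv_eq_iff_eq, hx, mul_inv_cancel_left]

theorem incl_injective : Function.Injective (incl n) := by
  intro β γ h
  have h1 := forget_incl β 1
  rw [h, forget_incl, Prod.mk.injEq, mul_one, mul_one] at h1
  exact h1.2.symm

theorem sigma_last_ne_incl (hn : 1 ≤ n) (β : ArtinBraid n) : sigma (n + 1) n ≠ incl n β := by
  intro h
  have h1 := forget_incl β 1
  rw [← h, forget_sigma (by omega), forgetStep_succ, Prod.mk.injEq] at h1
  omega

end ArtinBraid

end

/-! ### Tails, and existence and uniqueness of splittings -/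

section

open Equiv ArtinBraid

namespace BKL

variable {n : ℕ}

theorem coe_incl (β : BKL n) : (incl n β : ArtinBraid (n + 1)) = ArtinBraid.incl n β := rfl

theorem incl_injective : Function.Injective (incl n) := fun _ _ h =>
  Subtype.ext (ArtinBraid.incl_injective (congrArg Subtype.val h))

theorem mem_map_incl {x : ArtinBraid (n + 1)} :
    x ∈ (BKL n).map (ArtinBraid.incl n) ↔ ∃ y : BKL n, x = incl n y :=
  ⟨fun ⟨y, hy, h⟩ => ⟨⟨y, hy⟩, h.symm⟩, fun ⟨y, h⟩ => ⟨y, y.2, h.symm⟩⟩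

theorem length_incl (β : BKL n) :
    ArtinBraid.length (n + 1) (incl n β) = ArtinBraid.length n β := by
  obtain ⟨β, hβ⟩ := β
  change ArtinBraid.length (n + 1) (ArtinBraid.incl n β) = ArtinBraid.length n β
  induction hβ using Submonoid.closure_induction with
  | mem x hx =>
    obtain ⟨p, q, h1, h2, h3, rfl⟩ := hx
    rw [incl_a n h1 h2 h3, length_a h1 h2 h3, length_a h1 h2 (by omega)]
  | one => rw [map_one, length_one, length_one]
  | mul x y hx hy h1 h2 =>
    rw [map_mul, length_mul (incl_mem n ⟨x, hx⟩) (incl_mem n ⟨y, hy⟩), h1, h2, length_mul hx hy]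

theorem eq_one_of_length {β : BKL n} (h : ArtinBraid.length n β = 0) : β = 1 :=
  Subtype.ext (ArtinBraid.eq_one_of_length β.2 h)

theorem rightDvd_refl (β : ArtinBraid n) : RightDvd n β β := ⟨1, one_mem _, (one_mul β).symm⟩

theorem rightDvd_antisymm {x y : BKL n} (h1 : RightDvd n x y) (h2 : RightDvd n y x) : x = y := by
  obtain ⟨u, hu, e1⟩ := h1
  obtain ⟨v, hv, e2⟩ := h2
  have l1 := length_mul hu x.2
  have l2 := length_mul hv y.2
  rw [← e1] at l1
  rw [← e2] at l2
  have h := ArtinBraid.eq_one_of_length hu (by omega)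
  rw [h, one_mul] at e1
  exact Subtype.ext e1.symm

theorem eq_one_of_rightDvd_one {x : BKL n} (h : RightDvd n x 1) : x = 1 :=
  rightDvd_antisymm h ⟨x, x.2, (mul_one _).symm⟩

theorem IsTail.unique {β : ArtinBraid (n + 1)} {x y : BKL n} (h1 : IsTail n β x)
    (h2 : IsTail n β y) : x = y :=
  rightDvd_antisymm (h2.2 x h1.1) (h1.2 y h2.1)

theorem isTail_one_of_mul {γ : ArtinBraid (n + 1)} {x : BKL n} (hγ : γ ∈ BKL (n + 1))
    (h : IsTail n (γ * incl n x) x) : IsTail n γ 1 := by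
  refine ⟨⟨γ, hγ, by simp⟩, ?_⟩
  rintro y ⟨δ, hδ, rfl⟩
  obtain ⟨u, hu, e⟩ := h.2 (y * x) ⟨δ, hδ, by rw [map_mul, Submonoid.coe_mul, mul_assoc]⟩
  refine ⟨u, hu, ?_⟩
  rw [Submonoid.coe_mul, ← mul_assoc, eq_comm, mul_eq_right] at e
  exact e.symm

/-- A divisor `y` from the smaller monoid has with `x` a common multiple `u x` that still divides `γ
x`. Cancelling `x`, the factor `u` divides `γ` and is therefore trivial, so `y` divides `x`. -/
theorem isTail_mul {γ : ArtinBraid (n + 2)} (hγ : γ ∈ BKL (n + 2)) (h : IsTail (n + 1) γ 1)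
    (x : BKL (n + 1)) : IsTail (n + 1) (γ * incl (n + 1) x) x := by
  have hx : RightDvd (n + 2) (incl (n + 1) x) (γ * incl (n + 1) x) := ⟨γ, hγ, rfl⟩
  refine ⟨hx, fun y hy => ?_⟩
  obtain ⟨z, -, ⟨u, hu, e1⟩, ⟨v, hv, e2⟩, ⟨g, hg, e3⟩⟩ :=
    exists_common_multiple (mul_mem hγ (incl _ x).2) (mem_map_incl.2 ⟨x, rfl⟩)
      (mem_map_incl.2 ⟨y, rfl⟩) hx hy
  obtain ⟨u, rfl⟩ := mem_map_incl.1 hu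
  obtain ⟨v, rfl⟩ := mem_map_incl.1 hv
  rw [e1, ← mul_assoc] at e3
  have h1 := eq_one_of_rightDvd_one (h.2 u ⟨g, hg, mul_right_cancel e3⟩)
  rw [h1, map_one, Submonoid.coe_one, one_mul] at e1
  rw [e1] at e2
  refine ⟨v, v.2, ?_⟩
  have : x = v * y := incl_injective (Subtype.ext (by rw [map_mul]; exact e2))
  rw [this]
  rfl

/-- A divisor of maximal length equals its common multiple with any other divisor. -/
theorem exists_isTail {β : ArtinBraid (n + 2)} (hβ : β ∈ BKL (n + 2)) :
    ∃ τ, IsTail (n + 1) β τ := by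
  classical
  have h1 : ∀ τ : BKL (n + 1), RightDvd (n + 2) (incl (n + 1) τ) β →
      ArtinBraid.length (n + 1) τ ≤ ArtinBraid.length (n + 2) β := by
    rintro τ ⟨γ, hγ, rfl⟩
    rw [length_mul hγ (incl _ τ).2, length_incl]
    omega
  let P : ℕ → Prop := fun k => ∃ τ : BKL (n + 1), RightDvd (n + 2) (incl (n + 1) τ) β ∧
    ArtinBraid.length (n + 1) τ = k
  have h0 : P 0 := ⟨1, ⟨β, hβ, by simp⟩, length_one⟩
  obtain ⟨τ, h2, h3⟩ := Nat.findGreatest_spec (P := P) (Nat.zero_le (ArtinBraid.length (n + 2) β)) h0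
  refine ⟨τ, h2, fun y hy => ?_⟩
  obtain ⟨z, -, ⟨u, hu, e1⟩, ⟨v, hv, e2⟩, e3⟩ :=
    exists_common_multiple hβ (mem_map_incl.2 ⟨τ, rfl⟩) (mem_map_incl.2 ⟨y, rfl⟩) h2 hy
  obtain ⟨u, rfl⟩ := mem_map_incl.1 hu
  obtain ⟨v, rfl⟩ := mem_map_incl.1 hv
  have e4 : RightDvd (n + 2) (incl (n + 1) (u * τ)) β := by
    rw [map_mul, Submonoid.coe_mul, ← e1]
    exact e3
  have h4 := Nat.le_findGreatest (P := P) (h1 _ e4) ⟨_, e4, rfl⟩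
  rw [← h3, Submonoid.coe_mul, length_mul u.2 τ.2] at h4
  have h5 : u = 1 := eq_one_of_length (by omega)
  rw [h5, map_one, Submonoid.coe_one, one_mul] at e1
  rw [e1] at e2
  refine ⟨v, v.2, ?_⟩
  have : τ = v * y := incl_injective (Subtype.ext (by rw [map_mul]; exact e2))
  rw [this]
  rfl

theorem phi_mem {β : ArtinBraid n} (h : β ∈ BKL n) : phi n β ∈ BKL n := by
  suffices h' : BKL n ≤ (BKL n).comap (phi n).toMonoidHom from h' h
  refine Submonoid.closure_le.2 ?_
  rintro _ ⟨p, q, h1, h2, h3, rfl⟩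
  apply Submonoid.subset_closure
  by_cases h4 : q < n
  · exact ⟨p + 1, q + 1, by omega, by omega, by omega, phi_a h1 h2 h4⟩
  · obtain rfl : q = n := by omega
    exact ⟨1, p + 1, by omega, by omega, by omega, phi_a_last h1 h2⟩

theorem phi_symm_mem {β : ArtinBraid n} (h : β ∈ BKL n) : (phi n).symm β ∈ BKL n := by
  suffices h' : BKL n ≤ (BKL n).comap (phi n).symm.toMonoidHom from h' h
  refine Submonoid.closure_le.2 ?_
  rintro _ ⟨p, q, h1, h2, h3, rfl⟩
  apply Submonoid.subset_closure
  by_cases h4 : 2 ≤ p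
  · refine ⟨p - 1, q - 1, by omega, by omega, by omega, (phi n).symm_apply_eq.2 ?_⟩
    rw [phi_a (by omega) (by omega) (by omega)]
    congr 1 <;> omega
  · obtain rfl : p = 1 := by omega
    refine ⟨q - 1, n, by omega, by omega, by omega, (phi n).symm_apply_eq.2 ?_⟩
    rw [phi_a_last (by omega) (by omega)]
    congr 1
    omega

theorem length_phi (β : ArtinBraid n) : ArtinBraid.length n (phi n β) = ArtinBraid.length n β := by
  have h : expSum n (phi n β) = expSum n β := by
    rw [phi_apply, map_mul, map_mul, map_inv, mul_comm, inv_mul_cancel_left]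
  rw [ArtinBraid.length, h, ArtinBraid.length]

theorem length_phi_symm (β : ArtinBraid n) :
    ArtinBraid.length n ((phi n).symm β) = ArtinBraid.length n β := by
  rw [← length_phi, MulEquiv.apply_symm_apply]

/-- The definition unfolds at the leading entry, whereas tails are removed at the last one; this
form drives all inductions on splittings. -/
theorem rotProd_append (s : List (BKL n)) (x : BKL n) :
    rotProd n (s ++ [x]) = phi (n + 1) (rotProd n s) * incl n x := by
  induction s with
  | nil => simp [rotProd]
  | cons β s ih =>
    rw [List.cons_append, rotProd, ih, rotProd, map_mul, List.length_append, List.length_singleton,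
      pow_succ', MulAut.mul_apply, mul_assoc]

theorem rotProd_mem (s : List (BKL n)) : rotProd n s ∈ BKL (n + 1) := by
  induction s using List.reverseRecOn with
  | nil => exact one_mem _
  | append_singleton s x ih =>
    rw [rotProd_append]
    exact mul_mem (phi_mem ih) (incl n x).2

theorem length_rotProd_append (s : List (BKL n)) (x : BKL n) :
    ArtinBraid.length (n + 1) (rotProd n (s ++ [x])) =
      ArtinBraid.length (n + 1) (rotProd n s) + ArtinBraid.length n x := by
  rw [rotProd_append, length_mul (phi_mem (rotProd_mem s)) (incl n x).2, length_phi, length_incl]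

/-- The sequences which arise by removing at least the last entry of a splitting. -/
def IsReduced (n : ℕ) (s : List (BKL n)) : Prop :=
  s.head? ≠ some 1 ∧ ∀ j < s.length, IsTail n (phi (n + 1) (rotProd n (s.take j))) 1

theorem isTail_take_append {s : List (BKL n)} {x : BKL n} :
    (∀ j < (s ++ [x]).length, IsTail n (phi (n + 1) (rotProd n ((s ++ [x]).take j))) 1) ↔
      (∀ j < s.length, IsTail n (phi (n + 1) (rotProd n (s.take j))) 1) ∧
      IsTail n (phi (n + 1) (rotProd n s)) 1 := by
  rw [List.length_append, List.length_singleton]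
  constructor
  · intro h
    refine ⟨fun j hj => ?_, ?_⟩
    · have := h j (by omega)
      rwa [List.take_append_of_le_length hj.le] at this
    · have := h s.length (by omega)
      rwa [List.take_append_of_le_length le_rfl, List.take_length] at this
  · rintro ⟨h1, h2⟩ j hj
    rcases (by omega : j < s.length ∨ j = s.length) with h3 | rfl
    · rw [List.take_append_of_le_length h3.le]
      exact h1 j h3
    · rwa [List.take_append_of_le_length le_rfl, List.take_length]

theorem isReduced_nil : IsReduced n [] := ⟨by simp, by simp⟩

theorem isReduced_append {s : List (BKL n)} {x : BKL n} :
    IsReduced n (s ++ [x]) ↔ IsReduced n s ∧ IsTail n (phi (n + 1) (rotProd n s)) 1 ∧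
      (s = [] → x ≠ 1) := by
  rw [IsReduced, isTail_take_append, IsReduced]
  cases s <;> simp <;> tauto

theorem isSplitting_append {β : BKL (n + 1)} {s : List (BKL n)} {x : BKL n} :
    IsSplitting n β (s ++ [x]) ↔ IsReduced n s ∧ IsTail n (phi (n + 1) (rotProd n s)) 1 ∧
      (β : ArtinBraid (n + 1)) = phi (n + 1) (rotProd n s) * incl n x := by
  have h1 : (∀ k, 1 ≤ k → k ≤ (s ++ [x]).length →
      IsTail n (phi (n + 1) (rotProd n ((s ++ [x]).take ((s ++ [x]).length - k)))) 1) ↔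
      ∀ j < (s ++ [x]).length, IsTail n (phi (n + 1) (rotProd n ((s ++ [x]).take j))) 1 := by
    constructor
    · intro h j hj
      have := h ((s ++ [x]).length - j) (by omega) (by omega)
      rwa [Nat.sub_sub_self hj.le] at this
    · intro h k h1 h2
      exact h _ (by omega)
  rw [IsSplitting, h1, isTail_take_append, rotProd_append, IsReduced]
  cases s <;> simp <;> tauto

theorem exists_append_of_isSplitting {β : BKL (n + 1)} {s : List (BKL n)} (h : IsSplitting n β s) :
    ∃ t x, s = t ++ [x] := by
  rcases List.eq_nil_or_concat s with h1 | ⟨t, x, h1⟩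
  · exact absurd h1 h.1
  · exact ⟨t, x, h1.trans List.concat_eq_append⟩

theorem rotProd_ne_one {s : List (BKL n)} (h : IsReduced n s) (hs : s ≠ []) : rotProd n s ≠ 1 := by
  suffices h' : ArtinBraid.length (n + 1) (rotProd n s) ≠ 0 by
    intro h1
    rw [h1, length_one] at h'
    exact h' rfl
  induction s using List.reverseRecOn with
  | nil => exact absurd rfl hs
  | append_singleton s x ih =>
    obtain ⟨h1, -, h2⟩ := isReduced_append.1 h
    rw [length_rotProd_append]
    by_cases h3 : s = []
    · have : ArtinBraid.length n x ≠ 0 := fun h4 => h2 h3 (eq_one_of_length h4)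
      omega
    · have := ih h1 h3
      omega

/-- By `isTail_mul` each last entry is the tail of the common product, and tails are unique. -/
theorem append_eq_of_isTail {s t : List (BKL (n + 1))} {x y : BKL (n + 1)}
    (h1 : IsTail (n + 1) (phi (n + 2) (rotProd (n + 1) s)) 1)
    (h2 : IsTail (n + 1) (phi (n + 2) (rotProd (n + 1) t)) 1)
    (h : phi (n + 2) (rotProd (n + 1) s) * incl (n + 1) x =
      phi (n + 2) (rotProd (n + 1) t) * incl (n + 1) y) :
    x = y ∧ rotProd (n + 1) s = rotProd (n + 1) t := by
  have h3 := isTail_mul (phi_mem (rotProd_mem s)) h1 x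
  have h4 := isTail_mul (phi_mem (rotProd_mem t)) h2 y
  rw [h] at h3
  obtain rfl := h3.unique h4
  exact ⟨rfl, (phi _).injective (mul_right_cancel h)⟩

theorem IsReduced.unique {s t : List (BKL (n + 1))} (hs : IsReduced (n + 1) s)
    (ht : IsReduced (n + 1) t) (h : rotProd (n + 1) s = rotProd (n + 1) t) : s = t := by
  induction s using List.reverseRecOn generalizing t with
  | nil =>
    by_contra h1
    exact rotProd_ne_one ht (Ne.symm h1) h.symm
  | append_singleton s x ih =>
    rcases List.eq_nil_or_concat t with rfl | ⟨t, y, rfl⟩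
    · exact absurd h (rotProd_ne_one hs (by simp))
    · rw [List.concat_eq_append] at ht h ⊢
      obtain ⟨h1, h2, -⟩ := isReduced_append.1 hs
      obtain ⟨h3, h4, -⟩ := isReduced_append.1 ht
      rw [rotProd_append, rotProd_append] at h
      obtain ⟨rfl, e⟩ := append_eq_of_isTail h2 h4 h
      rw [ih h1 h3 e]

theorem IsSplitting.unique {β : BKL (n + 2)} {s t : List (BKL (n + 1))}
    (hs : IsSplitting (n + 1) β s) (ht : IsSplitting (n + 1) β t) : s = t := by
  obtain ⟨s, x, rfl⟩ := exists_append_of_isSplitting hs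
  obtain ⟨t, y, rfl⟩ := exists_append_of_isSplitting ht
  obtain ⟨h1, h2, h3⟩ := isSplitting_append.1 hs
  obtain ⟨h4, h5, h6⟩ := isSplitting_append.1 ht
  obtain ⟨rfl, e⟩ := append_eq_of_isTail h2 h5 (h3.symm.trans h6)
  rw [h1.unique h4 e]

theorem exists_tail_decomposition {β : ArtinBraid (n + 2)} (hβ : β ∈ BKL (n + 2)) :
    ∃ γ ∈ BKL (n + 2), ∃ τ, β = phi (n + 2) γ * incl (n + 1) τ ∧
      IsTail (n + 1) (phi (n + 2) γ) 1 ∧ IsTail (n + 1) β τ := by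
  obtain ⟨τ, h⟩ := exists_isTail hβ
  obtain ⟨γ, hγ, rfl⟩ := h.1
  refine ⟨(phi _).symm γ, phi_symm_mem hγ, τ, ?_, ?_, h⟩
  · rw [MulEquiv.apply_symm_apply]
  · rw [MulEquiv.apply_symm_apply]
    exact isTail_one_of_mul hγ h

theorem rightDvd_incl_a {β γ : ArtinBraid (n + 1)} (hγ : γ ∈ BKL (n + 1)) {p q : ℕ} (h1 : 1 ≤ p)
    (h2 : p < q) (h3 : q ≤ n) (h : β = γ * a (n + 1) p q) :
    ∃ x : BKL n, x ≠ 1 ∧ RightDvd (n + 1) (incl n x) β := by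
  refine ⟨gen n p q h1 h2 h3, ?_, γ, hγ, ?_⟩
  · intro h4
    have : ArtinBraid.length n (gen n p q h1 h2 h3 : ArtinBraid n) = 1 := length_a h1 h2 h3
    rw [h4, Submonoid.coe_one, length_one] at this
    omega
  · rw [h, coe_incl]
    exact congrArg _ (incl_a n h1 h2 h3).symm

/-- One of the first rotations of a nontrivial element has a nontrivial tail. -/
theorem exists_rotation {β : ArtinBraid (n + 3)} (hβ : β ∈ BKL (n + 3)) (h : β ≠ 1) :
    ∃ k ≤ 2, ∃ x : BKL (n + 2), x ≠ 1 ∧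
      RightDvd (n + 3) (incl (n + 2) x) ((phi (n + 3)).symm^[k] β) := by
  rcases eq_one_or_mul_a hβ with h1 | ⟨γ, hγ, p, q, h1, h2, h3, rfl⟩
  · exact absurd h1 h
  by_cases h4 : q ≤ n + 2
  · exact ⟨0, by omega, rightDvd_incl_a hγ h1 h2 h4 rfl⟩
  obtain rfl : q = n + 3 := by omega
  have key : ∀ p, 2 ≤ p → p < n + 3 → (phi (n + 3)).symm (a (n + 3) p (n + 3)) =
      a (n + 3) (p - 1) (n + 2) := by
    intro p h5 h6
    rw [(phi (n + 3)).symm_apply_eq, phi_a (by omega) (by omega) (by omega), Nat.sub_add_cancel]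
    omega
  by_cases h5 : 2 ≤ p
  · refine ⟨1, by omega, rightDvd_incl_a (phi_symm_mem hγ) (p := p - 1) (q := n + 2) (by omega)
      (by omega) le_rfl ?_⟩
    rw [Function.iterate_one, map_mul, key p h5 h2]
  -- The atom joining the first and last points rotates back to the one joining the last two points,
  -- which still involves the last point; a second rotation is needed.
  · obtain rfl : p = 1 := by omega
    refine ⟨2, le_rfl, rightDvd_incl_a (phi_symm_mem (phi_symm_mem hγ)) (p := n + 1) (q := n + 2)
      (by omega) (by omega) le_rfl ?_⟩
    have h6 : (phi (n + 3)).symm (a (n + 3) 1 (n + 3)) = a (n + 3) (n + 2) (n + 3) := by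
      rw [(phi (n + 3)).symm_apply_eq, phi_a_last (by omega) (by omega)]
    change (phi (n + 3)).symm ((phi (n + 3)).symm _) = _
    rw [map_mul, map_mul, h6, key _ (by omega) (by omega)]
    rfl

/-- A nontrivial tail shortens the braid, so induction on length applies. A trivial tail only
rotates it, and `exists_rotation` bounds how often that can happen in a row. -/
theorem exists_isReduced {β : ArtinBraid (n + 3)} (hβ : β ∈ BKL (n + 3)) :
    ∃ s, IsReduced (n + 2) s ∧ rotProd (n + 2) s = β := by
  induction hk : ArtinBraid.length (n + 3) β using Nat.strong_induction_on generalizing β with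
  | _ k ih =>
    by_cases hβ1 : β = 1
    · exact ⟨[], isReduced_nil, hβ1.symm⟩
    have step : ∀ {β γ : ArtinBraid (n + 3)} {τ : BKL (n + 2)}, β ≠ 1 →
        β = phi (n + 3) γ * incl (n + 2) τ → IsTail (n + 2) (phi (n + 3) γ) 1 →
        (∃ s, IsReduced (n + 2) s ∧ rotProd (n + 2) s = γ) →
        ∃ s, IsReduced (n + 2) s ∧ rotProd (n + 2) s = β := by
      rintro β _ τ h1 rfl h3 ⟨s, h4, rfl⟩
      refine ⟨s ++ [τ], isReduced_append.2 ⟨h4, h3, ?_⟩, rotProd_append s τ⟩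
      rintro rfl rfl
      exact h1 (by simp [rotProd])
    have main : ∀ {β : ArtinBraid (n + 3)}, β ∈ BKL (n + 3) →
        ArtinBraid.length (n + 3) β = k → β ≠ 1 →
        ((∃ x : BKL (n + 2), x ≠ 1 ∧ RightDvd (n + 3) (incl (n + 2) x) β) ∨
          ∃ s, IsReduced (n + 2) s ∧ rotProd (n + 2) s = (phi (n + 3)).symm β) →
        ∃ s, IsReduced (n + 2) s ∧ rotProd (n + 2) s = β := by
      intro β hβ hk h1 h2
      obtain ⟨γ, hγ, τ, h3, h4, h5⟩ := exists_tail_decomposition hβ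
      refine step h1 h3 h4 ?_
      by_cases h6 : τ = 1
      · subst h6
        rcases h2 with ⟨x, hx, h7⟩ | h7
        · exact absurd (eq_one_of_rightDvd_one (h5.2 x h7)) hx
        · rw [h3, map_one, Submonoid.coe_one, mul_one, MulEquiv.symm_apply_apply] at h7
          exact h7
      · have h7 : ArtinBraid.length (n + 2) τ ≠ 0 := fun h8 => h6 (eq_one_of_length h8)
        have h8 : ArtinBraid.length (n + 3) β =
            ArtinBraid.length (n + 3) γ + ArtinBraid.length (n + 2) τ := by
          rw [h3, length_mul (phi_mem hγ) (incl _ τ).2, length_phi, length_incl]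
        exact ih _ (by omega) hγ rfl
    obtain ⟨j, -, hj⟩ := exists_rotation hβ hβ1
    clear ih step
    -- An inner induction on the number of rotations before a nontrivial tail appears; the length
    -- stays equal to `k` throughout.
    induction j generalizing β with
    | zero => exact main hβ hk hβ1 (Or.inl hj)
    | succ j ihj =>
      refine main hβ hk hβ1 (Or.inr (ihj (phi_symm_mem hβ) ?_ ?_ hj))
      · rw [length_phi_symm, hk]
      · exact fun h => hβ1 ((map_eq_one_iff _ (phi (n + 3)).symm.injective).1 h)

theorem exists_isSplitting (β : BKL (n + 3)) : ∃ s, IsSplitting (n + 2) β s := by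
  obtain ⟨γ, hγ, τ, h1, h2, -⟩ := exists_tail_decomposition β.2
  obtain ⟨s, h3, rfl⟩ := exists_isReduced hγ
  exact ⟨s ++ [τ], isSplitting_append.2 ⟨h3, h2, h1⟩⟩

end BKL

end

/-! ### The rotating order: well-ordering, successors and initial segments -/

section

open Equiv ArtinBraid

namespace List

/-- A list of the same length squeezed between two lists with common beginning `s` must begin with
`s`, by asymmetry at the first difference; its last entry would then lie between `x` and `y`. -/
theorem not_lex_between {α : Type*} {r : α → α → Prop} [Std.Asymm r] {x y : α}
    (h : ∀ z, ¬ (r x z ∧ r z y)) : ∀ (s t : List α), t.length = s.length + 1 →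
      ¬ (Lex r (s ++ [x]) t ∧ Lex r t (s ++ [y])) := by
  intro s
  induction s with
  | nil =>
    rintro t ht ⟨h1, h2⟩
    obtain ⟨z, rfl⟩ := List.length_eq_one_iff.1 ht
    exact h z ⟨List.lex_singleton_iff x z |>.1 h1, List.lex_singleton_iff z y |>.1 h2⟩
  | cons a s ih =>
    rintro t ht ⟨h1, h2⟩
    obtain ⟨b, t, rfl⟩ := List.exists_cons_of_length_eq_add_one ht
    rw [List.cons_append] at h1 h2
    cases h1 with
    | cons h1 => exact ih t (by simpa using ht) ⟨h1, List.lex_cons_iff.1 h2⟩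
    | rel h1 =>
      cases h2 with
      | cons h2 => exact asymm_of r h1 h1
      | rel h2 => exact asymm_of r h1 h2

theorem not_shortlex_between {α : Type*} {r : α → α → Prop} [Std.Asymm r] {x y : α}
    (h : ∀ z, ¬ (r x z ∧ r z y)) (s t : List α) :
      ¬ (Shortlex r (s ++ [x]) t ∧ Shortlex r t (s ++ [y])) := by
  simp only [shortlex_def, length_append, length_singleton]
  rintro ⟨h1 | ⟨h1, h1'⟩, h2 | ⟨h2, h2'⟩⟩
  · omega
  · omega
  · omega
  · exact not_lex_between h s t h2 ⟨h1', h2'⟩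

end List

namespace BKL

variable {n : ℕ}

theorem eq_pow_of_two (β : BKL 2) :
    (β : ArtinBraid 2) = a 2 1 2 ^ ArtinBraid.length 2 (β : ArtinBraid 2) := by
  obtain ⟨β, hβ⟩ := β
  change β = _ ^ ArtinBraid.length 2 β
  induction hβ using Submonoid.closure_induction with
  | mem x hx =>
    obtain ⟨p, q, h1, h2, h3, rfl⟩ := hx
    obtain rfl : p = 1 := by omega
    obtain rfl : q = 2 := by omega
    rw [length_a h1 h2 h3, pow_one]
  | one => rw [length_one, pow_zero]
  | mul x y hx hy h1 h2 => rw [length_mul hx hy, pow_add, ← h1, ← h2]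

theorem length_two_injective :
    Function.Injective fun β : BKL 2 => ArtinBraid.length 2 (β : ArtinBraid 2) := by
  intro β γ h
  apply Subtype.ext
  rw [eq_pow_of_two β, eq_pow_of_two γ]
  exact congrArg _ h

theorem rotLT_two {β γ : BKL 2} : RotLT 2 β γ ↔
    ArtinBraid.length 2 (β : ArtinBraid 2) < ArtinBraid.length 2 (γ : ArtinBraid 2) := by
  have h : ∀ b : ℕ, ArtinBraid.length 2 (a 2 1 2 ^ b) = b := by
    intro b
    simp [ArtinBraid.length, expSum_a (n := 2) le_rfl one_lt_two le_rfl]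
  constructor
  · rintro ⟨b, d, h1, h2, h3⟩
    rwa [h2, h3, h, h]
  · intro h1
    exact ⟨_, _, h1, eq_pow_of_two β, eq_pow_of_two γ⟩

/-- The splitting of an element of the dual braid monoid. -/
noncomputable def splitting (β : BKL (n + 3)) : List (BKL (n + 2)) := (exists_isSplitting β).choose

theorem isSplitting_splitting (β : BKL (n + 3)) : IsSplitting (n + 2) β (splitting β) :=
  (exists_isSplitting β).choose_spec

theorem IsSplitting.eq {β : BKL (n + 3)} {s : List (BKL (n + 2))} (h : IsSplitting (n + 2) β s) :
    splitting β = s := (isSplitting_splitting β).unique h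

theorem splitting_injective : Function.Injective (splitting (n := n)) := by
  intro β γ h
  apply Subtype.ext
  rw [(isSplitting_splitting β).2.2.1, h, ← (isSplitting_splitting γ).2.2.1]

theorem rotLT_iff {β γ : BKL (n + 3)} :
    RotLT (n + 3) β γ ↔ List.Shortlex (RotLT (n + 2)) (splitting β) (splitting γ) := by
  constructor
  · rintro ⟨s, t, h1, h2, h3⟩
    rwa [h1.eq, h2.eq]
  · intro h
    exact ⟨_, _, isSplitting_splitting β, isSplitting_splitting γ, h⟩

theorem isWellOrder_rotLT (n : ℕ) : IsWellOrder (BKL (n + 2)) (RotLT (n + 2)) := by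
  induction n with
  | zero =>
    have h : RotLT 2 = InvImage (· < ·) fun β : BKL 2 => ArtinBraid.length 2 (β : ArtinBraid 2) := by
      ext β γ
      exact rotLT_two
    change IsWellOrder (BKL 2) (RotLT 2)
    rw [h]
    exact { wf := InvImage.wf _ wellFounded_lt
            trichotomous := (InvImage.trichotomous length_two_injective).trichotomous }
  | succ n ih =>
    have h : RotLT (n + 3) = InvImage (List.Shortlex (RotLT (n + 2))) splitting := by
      ext β γ
      exact rotLT_iff
    change IsWellOrder (BKL (n + 3)) (RotLT (n + 3))
    rw [h]
    exact { wf := InvImage.wf _ (List.Shortlex.wf ih.wf)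
            trichotomous := (InvImage.trichotomous splitting_injective).trichotomous }

theorem isTail_one : IsTail n 1 1 := by
  refine ⟨⟨1, one_mem _, by simp⟩, fun y hy => ?_⟩
  have h := eq_one_of_rightDvd_one (x := incl n y) hy
  rw [incl_injective (h.trans (map_one (incl n)).symm)]
  exact rightDvd_refl _

theorem isTail_phi_rotProd_nil : IsTail n (phi (n + 1) (rotProd n [])) 1 := by
  rw [rotProd, map_one]
  exact isTail_one

theorem splitting_incl (β : BKL (n + 2)) : splitting (incl (n + 2) β) = [β] :=
  IsSplitting.eq ((isSplitting_append (s := [])).2 ⟨isReduced_nil, isTail_phi_rotProd_nil, by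
    rw [rotProd, map_one, one_mul]⟩)

theorem rotLT_incl {β γ : BKL (n + 2)} :
    RotLT (n + 3) (incl (n + 2) β) (incl (n + 2) γ) ↔ RotLT (n + 2) β γ := by
  rw [rotLT_iff, splitting_incl, splitting_incl, List.shortlex_singleton_iff]

theorem splitting_ne_nil (β : BKL (n + 3)) : splitting β ≠ [] := (isSplitting_splitting β).1

theorem not_rotLT_one (n : ℕ) (β : BKL (n + 2)) : ¬ RotLT (n + 2) β 1 := by
  induction n with
  | zero =>
    intro h
    have := rotLT_two.1 h
    rw [Submonoid.coe_one, length_one] at this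
    exact absurd this (Nat.not_lt_zero _)
  | succ n ih =>
    intro h
    have h := rotLT_iff.1 h
    have h1 := splitting_incl (1 : BKL (n + 2))
    rw [map_one] at h1
    rw [h1, List.shortlex_def, List.length_singleton] at h
    have h2 := List.length_pos_iff.2 (splitting_ne_nil β)
    rcases h with h | ⟨h, h3⟩
    · omega
    · obtain ⟨x, hx⟩ := List.length_eq_one_iff.1 h
      rw [hx, List.lex_singleton_iff] at h3
      exact ih x h3

/-- The conditions on a splitting do not constrain its last entry once the earlier entries are not
all missing, and a single entry is arbitrary. Since `a_{1,2}` comes from the smaller monoid,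
multiplying by it just multiplies that entry, and induction applies to the entry. -/
theorem rotLT_succ (n : ℕ) (β : BKL (n + 2)) :
    RotLT (n + 2) β (β * gen (n + 2) 1 2 le_rfl one_lt_two (by omega)) ∧
      ∀ γ, ¬ (RotLT (n + 2) β γ ∧
        RotLT (n + 2) γ (β * gen (n + 2) 1 2 le_rfl one_lt_two (by omega))) := by
  induction n with
  | zero =>
    have h : ArtinBraid.length 2 ((β * gen 2 1 2 le_rfl one_lt_two (by omega) : BKL 2) :
        ArtinBraid 2) = ArtinBraid.length 2 (β : ArtinBraid 2) + 1 := by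
      rw [Submonoid.coe_mul, length_mul β.2 (Subtype.prop _)]
      exact congrArg _ (length_a le_rfl one_lt_two le_rfl)
    change RotLT 2 _ _ ∧ ∀ γ : BKL 2, ¬ (RotLT 2 _ _ ∧ RotLT 2 _ _)
    simp only [rotLT_two]
    change _ < ArtinBraid.length 2 ((β * gen 2 1 2 le_rfl one_lt_two (by omega) : BKL 2) :
        ArtinBraid 2) ∧ ∀ γ, ¬ (_ ∧ _ < ArtinBraid.length 2
          ((β * gen 2 1 2 le_rfl one_lt_two (by omega) : BKL 2) : ArtinBraid 2))
    rw [h]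
    exact ⟨Nat.lt_succ_self _, fun γ h => by omega⟩
  | succ n ih =>
    have hw := isWellOrder_rotLT n
    obtain ⟨s, x, hs⟩ := exists_append_of_isSplitting (isSplitting_splitting β)
    have h1 := isSplitting_splitting β
    rw [hs] at h1
    obtain ⟨e1, e2, e3⟩ := isSplitting_append.1 h1
    have hg : gen (n + 3) 1 2 le_rfl one_lt_two (by omega) =
        incl (n + 2) (gen (n + 2) 1 2 le_rfl one_lt_two (by omega)) :=
      Subtype.ext (incl_a (n + 2) le_rfl one_lt_two (by omega)).symm
    have h2 : IsSplitting (n + 2) (β * gen (n + 3) 1 2 le_rfl one_lt_two (by omega))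
        (s ++ [x * gen (n + 2) 1 2 le_rfl one_lt_two (by omega)]) := by
      refine isSplitting_append.2 ⟨e1, e2, ?_⟩
      rw [hg, Submonoid.coe_mul, e3, map_mul, Submonoid.coe_mul, mul_assoc]
    change RotLT (n + 3) _ _ ∧ ∀ γ : BKL (n + 3), ¬ (RotLT (n + 3) _ _ ∧ RotLT (n + 3) _ _)
    simp only [rotLT_iff]
    rw [h2.eq, hs]
    obtain ⟨i1, i2⟩ := ih x
    exact ⟨List.Shortlex.append_left ((List.shortlex_singleton_iff _ _).2 i1) s,
      fun γ => List.not_shortlex_between i2 s _⟩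

/-- An atom has length one, so a nontrivial right divisor would be the atom itself; but this atom is
`σ_{n+2}`, which moves the last strand. -/
theorem isTail_a_last (n : ℕ) : IsTail (n + 2) (a (n + 3) (n + 2) (n + 3)) 1 := by
  refine ⟨⟨_, (gen (n + 3) (n + 2) (n + 3) (by omega) (by omega) le_rfl).2, by simp; rfl⟩, ?_⟩
  rintro y ⟨γ, hγ, e⟩
  have h1 := length_mul hγ (incl (n + 2) y).2
  rw [← e, length_a (by omega) (by omega) le_rfl, length_incl] at h1
  by_cases h2 : ArtinBraid.length (n + 2) (y : ArtinBraid (n + 2)) = 0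
  · rw [eq_one_of_length h2]
    exact rightDvd_refl _
  · rw [ArtinBraid.eq_one_of_length hγ (by omega), one_mul, a_succ_self] at e
    exact absurd e (sigma_last_ne_incl (by omega) _)

theorem splitting_gen_last (n : ℕ) :
    splitting (gen (n + 3) (n + 2) (n + 3) (by omega) (by omega) le_rfl) =
      [gen (n + 2) (n + 1) (n + 2) (by omega) (by omega) le_rfl, 1] := by
  have h1 : gen (n + 2) (n + 1) (n + 2) (by omega) (by omega) le_rfl ≠ 1 := by
    intro h
    have : ArtinBraid.length (n + 2) (gen (n + 2) (n + 1) (n + 2) (by omega) (by omega) le_rfl :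
      ArtinBraid (n + 2)) = 1 := length_a (by omega) (by omega) le_rfl
    rw [h, Submonoid.coe_one, length_one] at this
    omega
  have h2 : phi (n + 3) (rotProd (n + 2) [gen (n + 2) (n + 1) (n + 2) (by omega) (by omega) le_rfl]) =
      a (n + 3) (n + 2) (n + 3) := by
    have h3 : (incl (n + 2) (gen (n + 2) (n + 1) (n + 2) (by omega) (by omega) le_rfl) :
        ArtinBraid (n + 3)) = a (n + 3) (n + 1) (n + 2) :=
      incl_a (n + 2) (by omega) (by omega) le_rfl
    rw [rotProd, rotProd, mul_one, List.length_nil, pow_zero, MulAut.one_apply, h3,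
      phi_a (by omega) (by omega) (by omega)]
  refine IsSplitting.eq ((isSplitting_append (s := [_])).2 ⟨?_, ?_, ?_⟩)
  · exact (isReduced_append (s := [])).2 ⟨isReduced_nil, isTail_phi_rotProd_nil, fun _ => h1⟩
  · rw [h2]
    exact isTail_a_last n
  · rw [h2, map_one, Submonoid.coe_one, mul_one]
    rfl

/-- Rotation raises both indices of an atom by one, and two inclusions leave room for this without
reaching the last strand. -/
theorem exists_phi_incl_incl (x : BKL n) :
    ∃ y : BKL (n + 1), phi (n + 2) (incl (n + 1) (incl n x)) = incl (n + 1) y := by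
  have h : BKL n ≤ ((BKL (n + 1)).map (ArtinBraid.incl (n + 1))).comap
      ((phi (n + 2)).toMonoidHom.comp ((ArtinBraid.incl (n + 1)).comp (ArtinBraid.incl n))) := by
    refine Submonoid.closure_le.2 ?_
    rintro _ ⟨p, q, h1, h2, h3, rfl⟩
    refine ⟨a (n + 1) (p + 1) (q + 1),
      Submonoid.subset_closure ⟨_, _, by omega, by omega, by omega, rfl⟩, ?_⟩
    change _ = phi (n + 2) (ArtinBraid.incl (n + 1) (ArtinBraid.incl n (a n p q)))
    rw [incl_a n h1 h2 h3, incl_a (n + 1) h1 h2 (by omega), phi_a h1 h2 (by omega),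
      incl_a (n + 1) (by omega) (by omega) (by omega)]
  exact mem_map_incl.1 (h x.2)

/-- A smaller splitting has length one or two. In length two the leading entries cannot agree, as
nothing is below the final entry `1`; so the leading entry is smaller, its rotation has trivial
tail, and `H` makes it trivial, which a splitting of length two forbids. -/
theorem exists_of_rotLT_gen_last_aux (β : BKL (n + 3))
    (h : RotLT (n + 3) β (gen (n + 3) (n + 2) (n + 3) (by omega) (by omega) le_rfl))
    (H : ∀ x : BKL (n + 2), RotLT (n + 2) x (gen (n + 2) (n + 1) (n + 2) (by omega) (by omega) le_rfl) →
      IsTail (n + 2) (phi (n + 3) (incl (n + 2) x)) 1 → x = 1) :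
    ∃ x, incl (n + 2) x = β := by
  have h := rotLT_iff.1 h
  rw [splitting_gen_last] at h
  obtain ⟨s, x, hs⟩ := exists_append_of_isSplitting (isSplitting_splitting β)
  have h1 := isSplitting_splitting β
  rw [hs] at h h1
  rcases List.eq_nil_or_concat s with rfl | ⟨s, y, rfl⟩
  · refine ⟨x, splitting_injective ?_⟩
    rw [splitting_incl, hs, List.nil_append]
  · rw [List.concat_eq_append] at h h1
    obtain ⟨h2, h3, -⟩ := isSplitting_append.1 h1
    obtain rfl : s = [] := by
      rcases List.shortlex_def.1 h with h4 | ⟨h4, -⟩ <;>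
      · simp only [List.length_append, List.length_cons, List.length_nil] at h4
        exact List.length_eq_zero_iff.1 (by omega)
    refine absurd (H y ?_ ?_) ((isReduced_append.1 h2).2.2 rfl)
    · have h4 := (List.shortlex_iff_lex (by simp)).1 h
      cases h4 with
      | cons h4 => exact absurd ((List.lex_singleton_iff x 1).1 h4) (not_rotLT_one n x)
      | rel h4 => exact h4
    · simpa [rotProd] using h3

/-- By induction the smaller leading entry comes from one strand fewer, so its rotation still lies
in the smaller monoid and is its own tail. On two strands, being below `a_{1,2}` already means being
trivial. -/
theorem exists_of_rotLT_gen_last (n : ℕ) (β : BKL (n + 3))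
    (h : RotLT (n + 3) β (gen (n + 3) (n + 2) (n + 3) (by omega) (by omega) le_rfl)) :
    ∃ x, incl (n + 2) x = β := by
  induction n with
  | zero =>
    refine exists_of_rotLT_gen_last_aux β h fun x hx _ => eq_one_of_length ?_
    have h1 := rotLT_two.1 hx
    have h2 : ArtinBraid.length 2 (gen 2 1 2 (by omega) (by omega) le_rfl : ArtinBraid 2) = 1 :=
      length_a le_rfl one_lt_two le_rfl
    change ArtinBraid.length 2 (x : ArtinBraid 2) = 0
    change _ < ArtinBraid.length 2 (gen 2 1 2 (by omega) (by omega) le_rfl : ArtinBraid 2) at h1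
    omega
  | succ n ih =>
    refine exists_of_rotLT_gen_last_aux β h fun x hx ht => ?_
    obtain ⟨y, rfl⟩ := ih x hx
    obtain ⟨z, hz⟩ := exists_phi_incl_incl y
    have h1 : z = 1 := eq_one_of_rightDvd_one (ht.2 z (by rw [hz]; exact rightDvd_refl _))
    rw [h1, map_one, Submonoid.coe_one, map_eq_one_iff _ (phi (n + 4)).injective] at hz
    have h2 : incl (n + 3) (incl (n + 2) y) = 1 := Subtype.ext hz
    exact incl_injective (h2.trans (map_one _).symm)

end BKL

end

theorem mainTheorem7 (n : ℕ) (hn : 2 ≤ n) :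
    -- `<*` is a well-ordering on `BKL_n`
    IsWellOrder (BKL n) (BKL.RotLT n) ∧
    -- the immediate successor of `β` is `β a_{1,2} = β σ_1`
    (BKL.gen n 1 2 le_rfl one_lt_two hn : ArtinBraid n) = ArtinBraid.sigma n 1 ∧
    (∀ β : BKL n,
      BKL.RotLT n β (β * BKL.gen n 1 2 le_rfl one_lt_two hn) ∧
      ∀ γ : BKL n, ¬ (BKL.RotLT n β γ ∧
        BKL.RotLT n γ (β * BKL.gen n 1 2 le_rfl one_lt_two hn))) ∧
    -- `BKL_n` embeds in `BKL_{n+1}`, compatibly with the rotating relations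
    Function.Injective (BKL.incl n) ∧
    (∀ β γ : BKL n, BKL.RotLT (n + 1) (BKL.incl n β) (BKL.incl n γ) ↔ BKL.RotLT n β γ) ∧
    -- its image is the initial segment of `BKL_{n+1}` determined by `a_{n,n+1}`
    Set.range (BKL.incl n) =
      {β : BKL (n + 1) | BKL.RotLT (n + 1) β
        (BKL.gen (n + 1) n (n + 1) (one_le_two.trans hn) n.lt_succ_self le_rfl)} ∧
    -- `a_{n,n+1}` is the least braid of `(n+1)`-breadth `2`
    BKL.HasBreadth n
      (BKL.gen (n + 1) n (n + 1) (one_le_two.trans hn) n.lt_succ_self le_rfl) 2 ∧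
    (∀ β : BKL (n + 1), BKL.HasBreadth n β 2 →
      β = BKL.gen (n + 1) n (n + 1) (one_le_two.trans hn) n.lt_succ_self le_rfl ∨
      BKL.RotLT (n + 1)
        (BKL.gen (n + 1) n (n + 1) (one_le_two.trans hn) n.lt_succ_self le_rfl) β) := by
  obtain ⟨n, rfl⟩ : ∃ m, n = m + 2 := ⟨n - 2, by omega⟩
  have hlast := BKL.splitting_gen_last n
  refine ⟨BKL.isWellOrder_rotLT n, ArtinBraid.a_succ_self 1, BKL.rotLT_succ n, BKL.incl_injective,
    fun β γ => BKL.rotLT_incl, ?_, ⟨_, BKL.isSplitting_splitting _, by rw [hlast]; rfl⟩, ?_⟩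
  · ext β
    constructor
    · rintro ⟨x, rfl⟩
      refine BKL.rotLT_iff.2 (List.Shortlex.of_length_lt ?_)
      rw [BKL.splitting_incl, hlast]
      simp
    · exact BKL.exists_of_rotLT_gen_last n β
  · rintro β ⟨s, hs, h2⟩
    have hw : IsWellOrder (BKL (n + 3)) (BKL.RotLT (n + 3)) := BKL.isWellOrder_rotLT (n + 1)
    -- Otherwise trichotomy puts `β` strictly below `a_{n,n+1}`, hence in the image of the smaller
    -- monoid, where splittings have length one.
    by_contra! h
    have h3 : BKL.RotLT (n + 3) β
        (BKL.gen (n + 3) (n + 2) (n + 3) (by omega) (by omega) le_rfl) := by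
      by_contra h4
      exact h.1 (hw.trichotomous _ _ h4 h.2)
    obtain ⟨x, rfl⟩ := BKL.exists_of_rotLT_gen_last n β h3
    rw [← hs.eq, BKL.splitting_incl] at h2
    simp at h2
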